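/- **Setting.** Let $K\ge 2$ and let $\mathcal F$ be a class of probability distributions on $\mathbb R$ with finite first moment; write $m(F)$ for the mean of $F$ and $\mathcal I=\{m(F): F\in\mathcal F\}$. Let $\mathcal T$ map distributions into a metric space $(E,d)$; it is injective on $\mathcal F$ and determines the mean: if $F\in\mathcal F$, $G$ has finite first moment and $\mathcal T(G)=\mathcal T(F)$, then $m(G)=m(F)$. (Examples: $\mathcal T=$ the cdf with the sup norm; $\mathcal T=m$ for a one-parameter exponential family.) For $F\in\mathcal F$, $u\in\mathcal I$ put $\mathcal K^{+}(F,u)=\inf\{\mathrm{KL}(F,G): G\in\mathcal F,\ m(G)>u\}$, $\mathcal K^{-}(F,u)=\inf\{\mathrm{KL}(F,G): G\in\mathcal F,\ m(G)<u\}$, in $[0,\infty]$, with $0\cdot\infty=0$. They are regarded as functions of $\mathcal T(F)$ and set to $0$ outside $\mathcal T(\mathcal F)$. For $t\in E^K$, $w\in[0,\infty)^K$ let $C_{i,j}(t,w)=\inf_{u\in\mathcal I}\{w_i\mathcal K^-(t_i,u)+w_j\mathcal K^+(t_j,u)\}$. Let $\beta\in(0,1)$ and let $\triangle$ be the simplex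 in $\mathbb R^K$. For $\boldsymbol F\in\mathcal F^K$ put $\mu_i=m(F_i)$ and $\mathcal T(\boldsymbol F)=(\mathcal T(F_i))_i$. If there is a unique best arm $i^\star$, put $T^\star_\beta(\boldsymbol F)^{-1}=\sup_{w\in\triangle,\,w_{i^\star}=\beta}\min_{j\ne i^\star}C_{i^\star,j}(\mathcal T(\boldsymbol F),w)$. **Algorithm.** In round $n+1$ a Top Two mechanism chooses a leader $B_{n+1}$ and a challenger $C_{n+1}\neq B_{n+1}$, both functions of the history of the first $n$ rounds (past internal randomness, pulled arms, observed rewards) and of fresh independent randomness. Each arm is pulled once in the first $K$ rounds; afterwards the leader is pulled with probability $\beta$ and the challenger otherwise, by an independent coin. A pull of arm $i$ gives an independent sample of $F_i$. Let $N_{n,i}$ be the number of pulls of arm $i$ in the first $n$ rounds, $F_{n,i}$ its empirical distribution, $\mathbb P_{|n}$ the conditional probability given the history of the first $n$ rounds, $\psi_{n+1,i}$ the conditional probability under $\mathbb P_{|n}$ of pulling arm $i$ in round $n+1$, and $\Psi_{n,i}=\sum_{t\le n}\psi_{t,i}$. For $n\ge K$ let $\widehat B_{n+1}\in\arg\max_i\mathbb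 P_{|n}[B_{n+1}=i]$ and $\widehat C_{n+1}\in\arg\max_{i\ne\widehat B_{n+1}}\mathbb P_{|n}[C_{n+1}=i\mid B_{n+1}=\widehat B_{n+1}]$, with any tie-breaking (e.g. uniform at random). Let $\hat\imath_n\in\arg\max_i m(F_{n,i})$, $W_n(i,j)=\inf_{u\in\mathcal I}\{N_{n,i}\mathcal K^-(\mathcal T(F_{n,i}),u)+N_{n,j}\mathcal K^+(\mathcal T(F_{n,j}),u)\}$, and $$\tau_\delta=\inf\{n\ge K:\ \min_{j\ne\hat\imath_n}W_n(\hat\imath_n,j)>c(n,\delta)\}.$$ The threshold $c\ge 0$ is *asymptotically tight*: there are $a\in[0,1)$, $\delta_0\in(0,1]$, $C\in\mathbb R$ and $f,S:(0,1]\to[0,\infty)$ such that $c(n,\delta)\le f(\delta)+Cn^{a}$ for $\delta\le\delta_0$, $n\ge S(\delta)$; $\limsup_{\delta\to0}f(\delta)/\log(1/\delta)\le1$; and $\limsup_{\delta\to 0}S(\delta)/\log(1/\delta)=0$. **Properties.** Statements about random variables are meant almost surely under $\mathbb P_{\boldsymbol F}$, simultaneously for all $L>0$ and $n$; thresholds $L_i$,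 $N_i$, $N_\epsilon$ are nonnegative random variables. In Properties 1–4, $n\ge K$. For $L>0$ let $S_n^L=\{i:N_{n,i}\ge L\}$, $U_n^L=\{i:N_{n,i}<\sqrt L\}$, $V_n^L=\{i:N_{n,i}<L^{3/4}\}$. *Sufficient exploration* means: there is $N_1$ with $\mathbb E_{\boldsymbol F}[N_1]<\infty$ and $N_{n,i}\ge\sqrt{n/K}$ for all $n\ge N_1$ and all $i$. 1. (leader, exploration) There is $L_0$ with $\mathbb E_{\boldsymbol F}[L_0^\alpha]<\infty$ for all $\alpha>0$ such that for $L\ge L_0$ and all $n$ with $S_n^L\neq\emptyset$: $\widehat B_{n+1}\in S_n^L$ implies $\widehat B_{n+1}\in\arg\max_{i\in S_n^L}\mu_i$. 2. (challenger, exploration) If Property 1 holds, there is $L_1$ with $\mathbb E_{\boldsymbol F}[L_1]<\infty$ such that for $L\ge L_1$ and all $n$ with $U_n^L\ne\emptyset$: $\widehat B_{n+1}\notin V_n^L$ implies $\widehat C_{n+1}\in V_n^L\cup\big(\arg\max_{i\notin V_n^L}\mu_i\setminus\{\widehat B_{n+1}\}\big)$. 3. (leader, convergence) Under sufficient exploration,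 there are $N_2$ with $\mathbb E_{\boldsymbol F}[N_2]<\infty$ and $g>0$ with $g(n)=o(n^{-\alpha})$ for some $\alpha>0$ such that $\mathbb P_{|n}[B_{n+1}\ne i^\star]\le g(n)$ for all $n\ge N_2$. 4. (challenger, convergence) Under sufficient exploration and Property 3, there is $\epsilon_0>0$ such that for every $\epsilon\in(0,\epsilon_0]$ there are $N_3$ with $\mathbb E_{\boldsymbol F}[N_3]<\infty$ and $h>0$ with $h(n)=o(n^{-\alpha})$ for some $\alpha>0$ such that for all $n\ge N_3$ and $i\ne i^\star$: $\Psi_{n,i}/n\ge w^\beta_i+\epsilon$ implies $\mathbb P_{|n}[C_{n+1}=i\mid B_{n+1}=i^\star]\le h(n)$, where $w^\beta$ is the optimal allocation of Property 5. 5. (continuity) $\mathcal T(F)\mapsto m(F)$ is continuous on $\mathcal T(\mathcal F)$. Over the instances $\boldsymbol F\in\mathcal F^K$ with a unique best arm $i^\star(\boldsymbol F)$ and all means in the interior of $\mathcal I$: the map $(\mathcal T(\boldsymbol F),w)\mapsto\min_{j\ne i^\star(\boldsymbol F)}C_{i^\star(\boldsymbol F),j}(\mathcal T(\boldsymbol F),w)$,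 $w\in\triangle$, is continuous, and the supremum defining $T^\star_\beta(\boldsymbol F)^{-1}$ is attained at exactly one allocation $w^\beta$, all of whose weights are positive. 6. (rate) For all $\epsilon>0$ there is $N_\epsilon$ with $\mathbb E_{\boldsymbol F}[N_\epsilon]<\infty$ such that for all $i$ and $n$ with $N_{n,i}\ge N_\epsilon$: $\mathcal T(F_{n,i})\in\mathcal T(\mathcal F)$ and $d(\mathcal T(F_{n,i}),\mathcal T(F_i))\le\epsilon$. **Corollary.** Assume that $\mathcal F$ satisfies Property 5. Let $\boldsymbol F\in\mathcal F^K$ have pairwise distinct means, all in the interior of $\mathcal I$. Consider a Top Two algorithm with the above stopping rule and an asymptotically tight threshold, and assume that under $\mathbb P_{\boldsymbol F}$ Property 6 holds, its leader satisfies Properties 1 and 3, and its challenger satisfies Properties 2 and 4. Then $$\limsup_{\delta\to0}\frac{\mathbb E_{\boldsymbol F}[\tau_\delta]}{\log(1/\delta)}\le T^\star_\beta(\boldsymbol F).$$ In particular, if these properties hold on all such instances, then the algorithm is asymptotically $\beta$-optimal on all of them. -/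

import Mathlib

open MeasureTheory ProbabilityTheory Filter Topology Set
open scoped ENNReal NNReal

namespace TopTwo

noncomputable section

/-! ### Classes of distributions, means, and the infima of Kullback-Leibler divergences -/

/-- The mean `m(F)`. -/
def mean (F : ProbabilityMeasure ℝ) : ℝ := ∫ x, x ∂(F : Measure ℝ)

/-- The set of means `{m(F) | F ∈ 𝓕}`. -/
def meanSet (𝓕 : Set (ProbabilityMeasure ℝ)) : Set ℝ := mean '' 𝓕

/-- `inf {KL(F, G) | G ∈ 𝓕, m(G) > u}`. -/
def KinfPlus (𝓕 : Set (ProbabilityMeasure ℝ)) (F : ProbabilityMeasure ℝ) (u : ℝ) : ℝ≥0∞ :=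
  ⨅ G ∈ {G | G ∈ 𝓕 ∧ u < mean G}, InformationTheory.klDiv (F : Measure ℝ) (G : Measure ℝ)

/-- `inf {KL(F, G) | G ∈ 𝓕, m(G) < u}`. -/
def KinfMinus (𝓕 : Set (ProbabilityMeasure ℝ)) (F : ProbabilityMeasure ℝ) (u : ℝ) : ℝ≥0∞ :=
  ⨅ G ∈ {G | G ∈ 𝓕 ∧ mean G < u}, InformationTheory.klDiv (F : Measure ℝ) (G : Measure ℝ)

/-- The operator `T` characterizes the members of the class `𝓕`, and `T(F)` determines the mean
(also when one of the two distributions is, e.g., an empirical distribution outside `𝓕`). -/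
structure IsCharacterization {E : Type*} (𝓕 : Set (ProbabilityMeasure ℝ))
    (T : ProbabilityMeasure ℝ → E) : Prop where
  injOn : InjOn T 𝓕
  mean_eq : ∀ F ∈ 𝓕, ∀ G : ProbabilityMeasure ℝ,
    Integrable (fun x : ℝ => x) (G : Measure ℝ) → T G = T F → mean G = mean F

/-- The function `KinfPlus` in terms of `t = T(F)`, `F ∈ 𝓕`. There is at most one such `F`, so the
supremum is the value at that `F`; it is `0` when `t` is not in `T(𝓕)`. -/
def KinfPlusOf {E : Type*} (𝓕 : Set (ProbabilityMeasure ℝ)) (T : ProbabilityMeasure ℝ → E)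
    (t : E) (u : ℝ) : ℝ≥0∞ :=
  ⨆ F ∈ {F | F ∈ 𝓕 ∧ T F = t}, KinfPlus 𝓕 F u

/-- The function `KinfMinus` in terms of `t = T(F)`, `F ∈ 𝓕`, with the same convention. -/
def KinfMinusOf {E : Type*} (𝓕 : Set (ProbabilityMeasure ℝ)) (T : ProbabilityMeasure ℝ → E)
    (t : E) (u : ℝ) : ℝ≥0∞ :=
  ⨆ F ∈ {F | F ∈ 𝓕 ∧ T F = t}, KinfMinus 𝓕 F u

/-- The transportation cost
`C_{i,j}(t, w) = inf_{u} { w_i Kinf⁻(t_i, u) + w_j Kinf⁺(t_j, u) }`, `u` in the set of means. -/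
def transportCost {K : ℕ} {E : Type*} (𝓕 : Set (ProbabilityMeasure ℝ))
    (T : ProbabilityMeasure ℝ → E) (i j : Fin K) (t : Fin K → E) (w : Fin K → ℝ) : ℝ≥0∞ :=
  ⨅ u ∈ meanSet 𝓕, (ENNReal.ofReal (w i) * KinfMinusOf 𝓕 T (t i) u +
    ENNReal.ofReal (w j) * KinfPlusOf 𝓕 T (t j) u)

/-- `min_{j ≠ i} C_{i,j}(t, w)`. -/
def minTransportCost {K : ℕ} {E : Type*} (𝓕 : Set (ProbabilityMeasure ℝ))
    (T : ProbabilityMeasure ℝ → E) (i : Fin K) (t : Fin K → E) (w : Fin K → ℝ) : ℝ≥0∞ :=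
  ⨅ j ∈ {j | j ≠ i}, transportCost 𝓕 T i j t w

/-! ### Instances, characteristic time, optimal allocations -/

/-- `i` is the unique arm with the highest mean. -/
def IsUniqueBest {K : ℕ} (F : Fin K → ProbabilityMeasure ℝ) (i : Fin K) : Prop :=
  ∀ j, j ≠ i → mean (F j) < mean (F i)

/-- The instances with arms in `𝓕`, unique best arm `i`, and all means in the interior of the set
of means. -/
def instances (K : ℕ) (𝓕 : Set (ProbabilityMeasure ℝ)) (i : Fin K) :
    Set (Fin K → ProbabilityMeasure ℝ) :=
  {F | (∀ k, F k ∈ 𝓕) ∧ IsUniqueBest F i ∧ ∀ k, mean (F k) ∈ interior (meanSet 𝓕)}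

/-- The allocations that give weight `β` to arm `i`. -/
def betaAllocations {K : ℕ} (β : ℝ) (i : Fin K) : Set (Fin K → ℝ) :=
  {w | w ∈ stdSimplex ℝ (Fin K) ∧ w i = β}

/-- The `β`-characteristic time of `F`, with best arm `i`: the inverse of
`sup {min_{j ≠ i} C_{i,j}(T(F), w) | w in the simplex, w_i = β}`. -/
def charTime {K : ℕ} {E : Type*} (𝓕 : Set (ProbabilityMeasure ℝ)) (T : ProbabilityMeasure ℝ → E)
    (β : ℝ) (F : Fin K → ProbabilityMeasure ℝ) (i : Fin K) : ℝ≥0∞ :=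
  (⨆ w ∈ betaAllocations β i, minTransportCost 𝓕 T i (fun k => T (F k)) w)⁻¹

/-- The set of `β`-optimal allocations of `F`, with best arm `i`. -/
def optimalAllocations {K : ℕ} {E : Type*} (𝓕 : Set (ProbabilityMeasure ℝ))
    (T : ProbabilityMeasure ℝ → E) (β : ℝ) (F : Fin K → ProbabilityMeasure ℝ) (i : Fin K) :
    Set (Fin K → ℝ) :=
  {w | w ∈ betaAllocations β i ∧ ∀ v ∈ betaAllocations β i,
    minTransportCost 𝓕 T i (fun k => T (F k)) v ≤ minTransportCost 𝓕 T i (fun k => T (F k)) w}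

/-- The continuity property of the class: the mean is a continuous function of `T(F)`, the minimal
transportation cost from the best arm is jointly continuous in `(T(F), w)`, and the `β`-optimal
allocation is unique and has positive weights. -/
structure ContinuityProperty {E : Type*} [MetricSpace E] (K : ℕ)
    (𝓕 : Set (ProbabilityMeasure ℝ)) (T : ProbabilityMeasure ℝ → E) (β : ℝ) : Prop where
  mean_continuous : ∃ m : E → ℝ, ContinuousOn m (T '' 𝓕) ∧ ∀ F ∈ 𝓕, m (T F) = mean F
  cost_continuous : ∀ i : Fin K,
    ContinuousOn (fun p : (Fin K → E) × (Fin K → ℝ) => minTransportCost 𝓕 T i p.1 p.2)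
      (((fun F : Fin K → ProbabilityMeasure ℝ => fun k => T (F k)) '' instances K 𝓕 i) ×ˢ
        stdSimplex ℝ (Fin K))
  unique_allocation : ∀ i : Fin K, ∀ F ∈ instances K 𝓕 i,
    ∃ w, optimalAllocations 𝓕 T β F i = {w} ∧ ∀ k, 0 < w k

/-! ### Top Two sampling rules -/

/-- What the algorithm records after `n` rounds: for each round the internal randomization (a seed
and the coin that decides between leader and challenger), the arm that was pulled, and the reward
that was observed. -/
abbrev History (K : ℕ) (𝒰 : Type*) (n : ℕ) : Type _ := Fin n → 𝒰 × unitInterval × Fin K × ℝ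

/-- A leader mechanism and a challenger mechanism: in each round they choose two distinct arms from
the past history and a fresh seed with law `seedLaw`. -/
structure Mechanism (K : ℕ) (𝒰 : Type*) [MeasurableSpace 𝒰] where
  seedLaw : ProbabilityMeasure 𝒰
  leader : (n : ℕ) → History K 𝒰 n → 𝒰 → Fin K
  challenger : (n : ℕ) → History K 𝒰 n → 𝒰 → Fin K
  measurable_leader : ∀ n, Measurable (fun p : History K 𝒰 n × 𝒰 => leader n p.1 p.2)
  measurable_challenger : ∀ n, Measurable (fun p : History K 𝒰 n × 𝒰 => challenger n p.1 p.2)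
  challenger_ne_leader : ∀ n h u, challenger n h u ≠ leader n h u

/-- The sample space: for each round a seed, a coin, and one potential reward for each arm. -/
abbrev Sample (K : ℕ) (𝒰 : Type*) : Type _ := ℕ → 𝒰 × unitInterval × (Fin K → ℝ)

section Run

variable {K : ℕ} {𝒰 : Type*} [MeasurableSpace 𝒰]

/-- The probability `ℙ_F`: over all rounds, the seeds (with law `seedLaw`), the coins (uniform on
`[0, 1]`) and the rewards of the arms (arm `i` with law `F i`) are independent. -/
def law (A : Mechanism K 𝒰) (F : Fin K → ProbabilityMeasure ℝ) : Measure (Sample K 𝒰) :=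
  Measure.infinitePi fun _ : ℕ => (A.seedLaw : Measure 𝒰).prod
    ((volume : Measure unitInterval).prod (Measure.pi fun i => (F i : Measure ℝ)))

/-- The arm pulled in round `n + 1`, given the history of the first `n` rounds, the seed `u` and the
coin `v`: each arm is pulled once in the first `K` rounds; afterwards the leader is pulled if
`v < β`, and the challenger otherwise. -/
def select (A : Mechanism K 𝒰) (β : ℝ) (n : ℕ) (h : History K 𝒰 n) (u : 𝒰) (v : unitInterval) :
    Fin K :=
  open Classical in
  if hn : n < K then ⟨n, hn⟩
  else if (v : ℝ) < β then A.leader n h u else A.challenger n h u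

/-- The history of the first `n` rounds. -/
def hist (A : Mechanism K 𝒰) (β : ℝ) (ω : Sample K 𝒰) : (n : ℕ) → History K 𝒰 n
  | 0 => Fin.elim0
  | n + 1 =>
    let a := select A β n (hist A β ω n) (ω n).1 (ω n).2.1
    Fin.snoc (hist A β ω n) ((ω n).1, (ω n).2.1, a, (ω n).2.2 a)

/-- The arm pulled in round `t + 1`. -/
def arm (A : Mechanism K 𝒰) (β : ℝ) (ω : Sample K 𝒰) (t : ℕ) : Fin K :=
  select A β t (hist A β ω t) (ω t).1 (ω t).2.1

/-- The reward observed in round `t + 1`. -/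
def reward (A : Mechanism K 𝒰) (β : ℝ) (ω : Sample K 𝒰) (t : ℕ) : ℝ :=
  (ω t).2.2 (arm A β ω t)

/-- The rounds among the first `n` in which arm `i` was pulled (round `t + 1` is listed as `t`). -/
def pulls (A : Mechanism K 𝒰) (β : ℝ) (ω : Sample K 𝒰) (n : ℕ) (i : Fin K) : Finset ℕ :=
  (Finset.range n).filter fun t => arm A β ω t = i

/-- The number of pulls `N_{n,i}`. -/
def numPulls (A : Mechanism K 𝒰) (β : ℝ) (ω : Sample K 𝒰) (n : ℕ) (i : Fin K) : ℕ :=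
  (pulls A β ω n i).card

lemma isProbabilityMeasure_average (s : Finset ℕ) (hs : s.Nonempty) (x : ℕ → ℝ) :
    IsProbabilityMeasure ((s.card : ℝ≥0∞)⁻¹ • ∑ t ∈ s, Measure.dirac (x t)) := by
  constructor
  have h0 : (s.card : ℝ≥0∞) ≠ 0 := by simpa using hs.ne_empty
  simp [ENNReal.inv_mul_cancel h0 (ENNReal.natCast_ne_top _)]

/-- The empirical distribution `F_{n,i}` (an arbitrary value before the first pull of arm `i`). -/
def empirical (A : Mechanism K 𝒰) (β : ℝ) (ω : Sample K 𝒰) (n : ℕ) (i : Fin K) :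
    ProbabilityMeasure ℝ :=
  if h : (pulls A β ω n i).Nonempty then
    ⟨((pulls A β ω n i).card : ℝ≥0∞)⁻¹ •
      ∑ t ∈ pulls A β ω n i, Measure.dirac (reward A β ω t), isProbabilityMeasure_average _ h _⟩
  else ⟨Measure.dirac 0, inferInstance⟩

/-- The conditional probability, given the first `n` rounds, that arm `i` is the leader of round
`n + 1`. -/
def leaderProb (A : Mechanism K 𝒰) (β : ℝ) (ω : Sample K 𝒰) (n : ℕ) (i : Fin K) : ℝ :=
  (A.seedLaw : Measure 𝒰).real {u | A.leader n (hist A β ω n) u = i}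

/-- The conditional probability, given the first `n` rounds, that arm `i` is the challenger of round
`n + 1`, given that `j` is its leader. -/
def challengerProb (A : Mechanism K 𝒰) (β : ℝ) (ω : Sample K 𝒰) (n : ℕ) (j i : Fin K) : ℝ :=
  (ProbabilityTheory.cond (A.seedLaw : Measure 𝒰) {u | A.leader n (hist A β ω n) u = j}).real
    {u | A.challenger n (hist A β ω n) u = i}

/-- The conditional probability `ψ_{n+1,i}`, given the first `n` rounds, that arm `i` is pulled in
round `n + 1`. -/
def pullProb (A : Mechanism K 𝒰) (β : ℝ) (ω : Sample K 𝒰) (n : ℕ) (i : Fin K) : ℝ :=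
  ((A.seedLaw : Measure 𝒰).prod (volume : Measure unitInterval)).real
    {p | select A β n (hist A β ω n) p.1 p.2 = i}

/-- `Ψ_{n,i} = ψ_{1,i} + ⋯ + ψ_{n,i}`. -/
def cumPullProb (A : Mechanism K 𝒰) (β : ℝ) (ω : Sample K 𝒰) (n : ℕ) (i : Fin K) : ℝ :=
  ∑ t ∈ Finset.range n, pullProb A β ω t i

/-- `B n` is an effective leader of round `n + 1`: it maximizes the conditional probability of being
the leader. Ties are broken in an arbitrary way, possibly at random. -/
def IsEffectiveLeader (A : Mechanism K 𝒰) (β : ℝ) (B : ℕ → Sample K 𝒰 → Fin K) : Prop :=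
  ∀ n, K ≤ n → ∀ ω i, leaderProb A β ω n i ≤ leaderProb A β ω n (B n ω)

/-- `C n` is an effective challenger of round `n + 1`: among the arms other than the effective
leader `B n`, it maximizes the conditional probability of being the challenger of `B n`. -/
def IsEffectiveChallenger (A : Mechanism K 𝒰) (β : ℝ) (B C : ℕ → Sample K 𝒰 → Fin K) : Prop :=
  ∀ n, K ≤ n → ∀ ω, C n ω ≠ B n ω ∧
    ∀ i, i ≠ B n ω → challengerProb A β ω n (B n ω) i ≤ challengerProb A β ω n (B n ω) (C n ω)

/-! ### Properties of the leader, the challenger and the empirical distributions -/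

/-- `N` is a nonnegative random variable with finite expectation. -/
def HasFiniteMean {Ω : Type*} [MeasurableSpace Ω] (P : Measure Ω) (N : Ω → ℝ≥0) : Prop :=
  Measurable N ∧ ∫⁻ ω, (N ω : ℝ≥0∞) ∂P < ∞

/-- The arms with the highest true mean in a set of arms. -/
def bestIn (F : Fin K → ProbabilityMeasure ℝ) (S : Set (Fin K)) : Set (Fin K) :=
  {i | i ∈ S ∧ ∀ j ∈ S, mean (F j) ≤ mean (F i)}

/-- The arms pulled at least `L` times in the first `n` rounds. -/
def sampledEnough (A : Mechanism K 𝒰) (β : ℝ) (ω : Sample K 𝒰) (n : ℕ) (L : ℝ) : Set (Fin K) :=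
  {i | L ≤ numPulls A β ω n i}

/-- The arms that are highly under-sampled: fewer than `√L` pulls in the first `n` rounds. -/
def highlyUnder (A : Mechanism K 𝒰) (β : ℝ) (ω : Sample K 𝒰) (n : ℕ) (L : ℝ) : Set (Fin K) :=
  {i | (numPulls A β ω n i : ℝ) < √L}

/-- The arms that are mildly under-sampled: fewer than `L^(3/4)` pulls in the first `n` rounds. -/
def mildlyUnder (A : Mechanism K 𝒰) (β : ℝ) (ω : Sample K 𝒰) (n : ℕ) (L : ℝ) : Set (Fin K) :=
  {i | (numPulls A β ω n i : ℝ) < L ^ (3 / 4 : ℝ)}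

/-- Exploration property of the leader: for `L ≥ L₀`, if the effective leader is sampled enough,
then it has the highest mean among the arms that are sampled enough. -/
def LeaderExplores (A : Mechanism K 𝒰) (β : ℝ) (F : Fin K → ProbabilityMeasure ℝ)
    (B : ℕ → Sample K 𝒰 → Fin K) : Prop :=
  ∃ L₀ : Sample K 𝒰 → ℝ≥0, Measurable L₀ ∧
    (∀ a : ℝ, 0 < a → ∫⁻ ω, (L₀ ω : ℝ≥0∞) ^ a ∂(law A F) < ∞) ∧
    ∀ᵐ ω ∂(law A F), ∀ L : ℝ, 0 < L → (L₀ ω : ℝ) ≤ L → ∀ n, K ≤ n →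
      (sampledEnough A β ω n L).Nonempty → B n ω ∈ sampledEnough A β ω n L →
      B n ω ∈ bestIn F (sampledEnough A β ω n L)

/-- Exploration property of the challenger: given a leader with the exploration property, for
`L ≥ L₁`, if some arm is highly under-sampled and the effective leader is not mildly under-sampled,
then the effective challenger is mildly under-sampled or has the highest mean among the arms that
are not. -/
def ChallengerExplores (A : Mechanism K 𝒰) (β : ℝ) (F : Fin K → ProbabilityMeasure ℝ)
    (B C : ℕ → Sample K 𝒰 → Fin K) : Prop :=
  LeaderExplores A β F B →
    ∃ L₁ : Sample K 𝒰 → ℝ≥0, HasFiniteMean (law A F) L₁ ∧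
      ∀ᵐ ω ∂(law A F), ∀ L : ℝ, 0 < L → (L₁ ω : ℝ) ≤ L → ∀ n, K ≤ n →
        (highlyUnder A β ω n L).Nonempty → B n ω ∉ mildlyUnder A β ω n L →
        C n ω ∈ mildlyUnder A β ω n L ∪ (bestIn F (mildlyUnder A β ω n L)ᶜ \ {B n ω})

/-- Sufficient exploration: all arms are pulled at least `√(n/K)` times for `n ≥ N₁`. -/
def SufficientExploration (A : Mechanism K 𝒰) (β : ℝ) (F : Fin K → ProbabilityMeasure ℝ) : Prop :=
  ∃ N₁ : Sample K 𝒰 → ℝ≥0, HasFiniteMean (law A F) N₁ ∧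
    ∀ᵐ ω ∂(law A F), ∀ n : ℕ, (N₁ ω : ℝ) ≤ n → ∀ i, √((n : ℝ) / K) ≤ numPulls A β ω n i

/-- `g : ℕ* → (0, ∞)` with `g(n) = o(n^(-a))` for some `a > 0`. -/
def PolynomialDecay (g : ℕ → ℝ) : Prop :=
  (∀ n, 1 ≤ n → 0 < g n) ∧ ∃ a : ℝ, 0 < a ∧ g =o[atTop] fun n : ℕ => (n : ℝ) ^ (-a)

/-- Convergence property of the leader: given sufficient exploration, for `n ≥ N₂` the conditional
probability that the leader is not the best arm `i` is at most `g(n)`. -/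
def LeaderConverges (A : Mechanism K 𝒰) (β : ℝ) (F : Fin K → ProbabilityMeasure ℝ)
    (i : Fin K) : Prop :=
  SufficientExploration A β F →
    ∃ g : ℕ → ℝ, PolynomialDecay g ∧
      ∃ N₂ : Sample K 𝒰 → ℝ≥0, HasFiniteMean (law A F) N₂ ∧
        ∀ᵐ ω ∂(law A F), ∀ n : ℕ, K ≤ n → (N₂ ω : ℝ) ≤ n →
          (A.seedLaw : Measure 𝒰).real {u | A.leader n (hist A β ω n) u ≠ i} ≤ g n

/-- Convergence property of the challenger: given sufficient exploration and a leader with the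
convergence property, for `n ≥ N₃` a suboptimal arm whose average pull probability exceeds its
`β`-optimal weight by at least `ε` is the challenger of the best arm `i` with conditional
probability at most `h(n)`. -/
def ChallengerConverges {E : Type*} (𝓕 : Set (ProbabilityMeasure ℝ))
    (T : ProbabilityMeasure ℝ → E) (A : Mechanism K 𝒰) (β : ℝ)
    (F : Fin K → ProbabilityMeasure ℝ) (i : Fin K) : Prop :=
  SufficientExploration A β F → LeaderConverges A β F i →
    ∀ w ∈ optimalAllocations 𝓕 T β F i,
      ∃ ε₀ : ℝ, 0 < ε₀ ∧ ∀ ε : ℝ, 0 < ε → ε ≤ ε₀ →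
        ∃ h : ℕ → ℝ, PolynomialDecay h ∧
          ∃ N₃ : Sample K 𝒰 → ℝ≥0, HasFiniteMean (law A F) N₃ ∧
            ∀ᵐ ω ∂(law A F), ∀ n : ℕ, K ≤ n → (N₃ ω : ℝ) ≤ n → ∀ k, k ≠ i →
              w k + ε ≤ cumPullProb A β ω n k / n → challengerProb A β ω n i k ≤ h n

/-- Convergence rate of the transformed empirical distributions: for all `ε > 0` there is `N` with
finite expectation such that `T(F_{n,i})` lies in `T(𝓕)`, at distance at most `ε` from `T(F_i)`, as
soon as arm `i` was pulled at least `N` times. -/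
def RateProperty {E : Type*} [MetricSpace E] (𝓕 : Set (ProbabilityMeasure ℝ))
    (T : ProbabilityMeasure ℝ → E) (A : Mechanism K 𝒰) (β : ℝ)
    (F : Fin K → ProbabilityMeasure ℝ) : Prop :=
  ∀ ε : ℝ, 0 < ε → ∃ N : Sample K 𝒰 → ℝ≥0, HasFiniteMean (law A F) N ∧
    ∀ᵐ ω ∂(law A F), ∀ (i : Fin K) (n : ℕ), (N ω : ℝ) ≤ numPulls A β ω n i →
      T (empirical A β ω n i) ∈ T '' 𝓕 ∧ dist (T (empirical A β ω n i)) (T (F i)) ≤ ε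

/-! ### Stopping rule -/

/-- The empirical transportation cost
`W_n(i,j) = inf_u { N_{n,i} Kinf⁻(T(F_{n,i}), u) + N_{n,j} Kinf⁺(T(F_{n,j}), u) }`. -/
def empCost {E : Type*} (𝓕 : Set (ProbabilityMeasure ℝ)) (T : ProbabilityMeasure ℝ → E)
    (A : Mechanism K 𝒰) (β : ℝ) (ω : Sample K 𝒰) (n : ℕ) (i j : Fin K) : ℝ≥0∞ :=
  transportCost 𝓕 T i j (fun k => T (empirical A β ω n k)) fun k => (numPulls A β ω n k : ℝ)

/-- `r n` is an arm with the highest empirical mean after `n` rounds, for each `n` after the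
initialization. Ties are broken in an arbitrary way. -/
def IsRecommendation (A : Mechanism K 𝒰) (β : ℝ) (r : ℕ → Sample K 𝒰 → Fin K) : Prop :=
  ∀ n, K ≤ n → ∀ ω i, mean (empirical A β ω n i) ≤ mean (empirical A β ω n (r n ω))

/-- The GLR stopping time: the first `n` after the initialization at which
`min_{j ≠ r n} W_n(r n, j) > c(n, δ)`, and `∞` if there is none. -/
def stoppingTime {E : Type*} (𝓕 : Set (ProbabilityMeasure ℝ)) (T : ProbabilityMeasure ℝ → E)
    (A : Mechanism K 𝒰) (β : ℝ) (r : ℕ → Sample K 𝒰 → Fin K) (c : ℕ → ℝ → ℝ≥0) (δ : ℝ)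
    (ω : Sample K 𝒰) : ℕ∞ :=
  ⨅ n ∈ {n : ℕ | K ≤ n ∧
    (c n δ : ℝ≥0∞) < ⨅ j ∈ {j | j ≠ r n ω}, empCost 𝓕 T A β ω n (r n ω) j}, (n : ℕ∞)

/-- `𝔼_F[τ_δ]`, in `[0, ∞]`. -/
def expectedStoppingTime {E : Type*} (𝓕 : Set (ProbabilityMeasure ℝ))
    (T : ProbabilityMeasure ℝ → E) (A : Mechanism K 𝒰) (β : ℝ) (F : Fin K → ProbabilityMeasure ℝ)
    (r : ℕ → Sample K 𝒰 → Fin K) (c : ℕ → ℝ → ℝ≥0) (δ : ℝ) : ℝ≥0∞ :=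
  ∫⁻ ω, (stoppingTime 𝓕 T A β r c δ ω : ℝ≥0∞) ∂(law A F)

end Run

/-- Asymptotically tight thresholds. Only the values at `δ ∈ (0, 1]` matter. -/
def AsymptoticallyTight (c : ℕ → ℝ → ℝ≥0) : Prop :=
  ∃ (a δ₀ C : ℝ) (f S : ℝ → ℝ≥0), 0 ≤ a ∧ a < 1 ∧ 0 < δ₀ ∧ δ₀ ≤ 1 ∧
    (∀ δ : ℝ, 0 < δ → δ ≤ δ₀ → ∀ n : ℕ, (S δ : ℝ) ≤ n →
      (c n δ : ℝ) ≤ f δ + C * (n : ℝ) ^ a) ∧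
    limsup (fun δ : ℝ => (f δ : ℝ≥0∞) / ENNReal.ofReal (Real.log (1 / δ))) (𝓝[>] 0) ≤ 1 ∧
    limsup (fun δ : ℝ => (S δ : ℝ≥0∞) / ENNReal.ofReal (Real.log (1 / δ))) (𝓝[>] 0) = 0

end

end TopTwo

/-!
The proof follows the pull counts `N_{n,i}` through the run; every random time that occurs has
a finite expectation, so that none of them matters after division by `log (1 / δ)`.

*Concentration.* `N_{n,i} - Ψ_{n,i}` is a martingale with bounded increments. Its exponential
moments are bounded by resampling the last coordinate of the sample space
(`IsCenteredIncrement.lintegral_exp_sum_le`), and hence `|N_{n,i} - Ψ_{n,i}| ≤ ε n + N` with a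
random constant `N` of finite expectation (`exists_abs_numPulls_sub_le`).

*Exploration.* Suppose that an arm has fewer than `√L` pulls after `n = K L` rounds. By the
exploration properties, in each earlier round the effective leader or the effective challenger has
fewer than `L^(3/4)` pulls: otherwise both would be the best among the arms with at least `L^(3/4)`
pulls, which is unique because the means are distinct. So arms with fewer than `L^(3/4)` pulls
accumulate a pull probability proportional to `n`. By concentration they cannot, and
`sufficientExploration` follows.

*Allocation.* By the convergence properties, `Ψ_{n,i} / n` exceeds the optimal weight of arm `i` by
at most `ε` for large `n`. Since both allocations sum to `1`, the lower bounds follow from the upper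
bounds, and `N_{n,i} / n` converges to the optimal allocation `w`
(`exists_abs_numPulls_sub_weight_le`).

*Stopping.* The weights `w` are positive, so every arm is pulled linearly often, and the empirical
distributions are close to the true ones in the metric of `T`. By continuity of the mean, the
recommended arm is then the best arm, and by continuity of the transportation cost, the statistic of
the stopping rule, which is `n` times the cost at the empirical distributions and allocation, is at
least `n v` for any `v` below the optimal cost (`exists_stoppingTime_le`). Comparing `n v` with
the threshold `log (1 / δ) + o(log (1 / δ)) + o(n)` gives the bound
(`limsup_expectedStoppingTime_le`).
-/

namespace TopTwo

/-! ### Random variables with finite expectation -/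

section FiniteMean

variable {Ω : Type*} [MeasurableSpace Ω] {P : Measure Ω}

theorem HasFiniteMean.add {N M : Ω → ℝ≥0} (hN : HasFiniteMean P N) (hM : HasFiniteMean P M) :
    HasFiniteMean P fun ω => N ω + M ω := by
  refine ⟨hN.1.add hM.1, ?_⟩
  simp only [ENNReal.coe_add]
  rw [lintegral_add_left hN.1.coe_nnreal_ennreal]
  exact ENNReal.add_lt_top.2 ⟨hN.2, hM.2⟩

theorem HasFiniteMean.const_mul {N : Ω → ℝ≥0} (hN : HasFiniteMean P N) (c : ℝ≥0) :
    HasFiniteMean P fun ω => c * N ω := by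
  refine ⟨hN.1.const_mul c, ?_⟩
  simp only [ENNReal.coe_mul]
  rw [lintegral_const_mul _ hN.1.coe_nnreal_ennreal]
  exact ENNReal.mul_lt_top ENNReal.coe_lt_top hN.2

theorem hasFiniteMean_const [IsFiniteMeasure P] (c : ℝ≥0) : HasFiniteMean P fun _ => c :=
  ⟨measurable_const, by simp [ENNReal.mul_lt_top_iff, measure_lt_top]⟩

theorem HasFiniteMean.sum {ι : Type*} {s : Finset ι} {N : ι → Ω → ℝ≥0}
    (hN : ∀ k ∈ s, HasFiniteMean P (N k)) : HasFiniteMean P fun ω => ∑ k ∈ s, N k ω := by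
  refine ⟨Finset.measurable_sum _ fun k hk => (hN k hk).1, ?_⟩
  simp only [ENNReal.ofNNReal_finsetSum]
  rw [lintegral_finsetSum' _ fun k hk => (hN k hk).1.coe_nnreal_ennreal.aemeasurable]
  exact ENNReal.sum_lt_top.2 fun k hk => (hN k hk).2

end FiniteMean

/-! ### Concentration of martingales with bounded increments -/

section Concentration

variable {X : Type*} [MeasurableSpace X]

/-- Resampling one coordinate preserves the law of an i.i.d. sequence. -/
theorem measurePreserving_update (ν : Measure X) [IsProbabilityMeasure ν] (n : ℕ) :
    MeasurePreserving (fun p : (ℕ → X) × X => Function.update p.1 n p.2)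
      ((Measure.infinitePi fun _ : ℕ => ν).prod ν) (Measure.infinitePi fun _ : ℕ => ν) := by
  have hm : Measurable (fun p : (ℕ → X) × X => Function.update p.1 n p.2) := by
    refine measurable_pi_lambda _ fun i => ?_
    by_cases h : i = n
    · subst h; simpa using measurable_snd
    · simp only [Function.update_of_ne h]
      exact (measurable_pi_apply i).comp measurable_fst
  refine ⟨hm, Measure.eq_infinitePi _ fun s t ht => ?_⟩
  rw [Measure.map_apply hm (MeasurableSet.pi s.countable_toSet fun i _ => ht i)]
  have hset : (fun p : (ℕ → X) × X => Function.update p.1 n p.2) ⁻¹' (Set.pi s t) =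
      (Set.pi (s.erase n : Finset ℕ) t) ×ˢ (if n ∈ s then t n else univ) := by
    ext ⟨ω, x⟩
    simp only [mem_preimage, Set.mem_pi, mem_prod, Finset.mem_coe, Finset.mem_erase]
    constructor
    · intro h
      refine ⟨fun i hi => by simpa [Function.update_of_ne hi.1] using h i hi.2, ?_⟩
      split_ifs with hn
      · simpa using h n hn
      · trivial
    · rintro ⟨h1, h2⟩ i hi
      by_cases hin : i = n
      · subst hin; simpa [hi] using h2
      · simpa [Function.update_of_ne hin] using h1 i ⟨hin, hi⟩
  rw [hset, Measure.prod_prod, Measure.infinitePi_pi _ (fun i _ => ht i)]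
  split_ifs with hn
  · rw [mul_comm, Finset.mul_prod_erase s (fun i => ν (t i)) hn]
  · simp [Finset.erase_eq_of_notMem hn]

theorem lintegral_exp_le_of_centered (ν : Measure X) [IsProbabilityMeasure ν] {D : X → ℝ}
    (hD : Measurable D) (hbd : ∀ x, |D x| ≤ 1) (hmean : ∫ x, D x ∂ν = 0) {l : ℝ} (hl : |l| ≤ 1) :
    ∫⁻ x, ENNReal.ofReal (Real.exp (l * D x)) ∂ν ≤ ENNReal.ofReal (Real.exp (l ^ 2)) := by
  have hle : ∀ x, Real.exp (l * D x) ≤ 1 + l * D x + l ^ 2 := fun x => by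
    have h1 : |l * D x| ≤ 1 := by
      rw [abs_mul]; exact mul_le_one₀ hl (abs_nonneg _) (hbd x)
    have h2 := (abs_le.1 (Real.abs_exp_sub_one_sub_id_le h1)).2
    have h3 : (l * D x) ^ 2 ≤ l ^ 2 := by
      rw [mul_pow]
      exact mul_le_of_le_one_right (sq_nonneg _) ((sq_le_one_iff_abs_le_one _).2 (hbd x))
    linarith
  have hDi : Integrable D ν := Integrable.of_bound hD.aestronglyMeasurable 1
    (Eventually.of_forall hbd)
  have hi : Integrable (fun x => 1 + l * D x + l ^ 2) ν :=
    ((integrable_const _).add (hDi.const_mul l)).add (integrable_const _)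
  calc ∫⁻ x, ENNReal.ofReal (Real.exp (l * D x)) ∂ν
      ≤ ∫⁻ x, ENNReal.ofReal (1 + l * D x + l ^ 2) ∂ν :=
        lintegral_mono fun x => ENNReal.ofReal_le_ofReal (hle x)
    _ = ENNReal.ofReal (∫ x, (1 + l * D x + l ^ 2) ∂ν) :=
        (ofReal_integral_eq_lintegral_ofReal hi (Eventually.of_forall fun x =>
          (Real.exp_nonneg _).trans (hle x))).symm
    _ = ENNReal.ofReal (1 + l ^ 2) := by
        have h1 : ∫ x, (1 + l * D x + l ^ 2) ∂ν = ∫ x, (1 + l * D x) ∂ν + ∫ _, l ^ 2 ∂ν :=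
          integral_add ((integrable_const _).add (hDi.const_mul l)) (integrable_const _)
        have h2 : ∫ x, (1 + l * D x) ∂ν = ∫ _, 1 ∂ν + ∫ x, l * D x ∂ν :=
          integral_add (integrable_const _) (hDi.const_mul l)
        rw [h1, h2, integral_const_mul, hmean]
        simp
    _ ≤ _ := ENNReal.ofReal_le_ofReal (by linarith [Real.add_one_le_exp (l ^ 2)])

/-- `D t ω (ω t)`, `t = 0, 1, …`, are bounded martingale increments: `D t ω` does not depend on the
coordinates of `ω` from `t` on, and `D t ω x` is centered in `x`. -/
structure IsCenteredIncrement (ν : Measure X) (D : ℕ → (ℕ → X) → X → ℝ) : Prop where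
  measurable : ∀ n, Measurable (fun p : (ℕ → X) × X => D n p.1 p.2)
  update : ∀ n m, n ≤ m → ∀ ω x, D n (Function.update ω m x) = D n ω
  abs_le : ∀ n ω x, |D n ω x| ≤ 1
  integral_eq : ∀ n ω, ∫ x, D n ω x ∂ν = 0

namespace IsCenteredIncrement

variable {ν : Measure X} {D : ℕ → (ℕ → X) → X → ℝ}

theorem measurable_eval (h : IsCenteredIncrement ν D) (n : ℕ) :
    Measurable fun ω : ℕ → X => D n ω (ω n) :=
  (h.measurable n).comp (measurable_id.prodMk (measurable_pi_apply n))

theorem measurable_sum (h : IsCenteredIncrement ν D) (n : ℕ) :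
    Measurable fun ω : ℕ → X => ∑ t ∈ Finset.range n, D t ω (ω t) :=
  Finset.measurable_sum _ fun t _ => h.measurable_eval t

theorem neg (h : IsCenteredIncrement ν D) : IsCenteredIncrement ν (fun n ω x => -D n ω x) where
  measurable n := (h.measurable n).neg
  update n m hnm ω x := by simp [h.update n m hnm ω x]
  abs_le n ω x := by simpa using h.abs_le n ω x
  integral_eq n ω := by rw [integral_neg, h.integral_eq, neg_zero]

/-- The exponential moment bound behind the Azuma-Hoeffding inequality; coordinate `n` is
resampled, so that it can be integrated out first. -/
theorem lintegral_exp_sum_le [IsProbabilityMeasure ν] (h : IsCenteredIncrement ν D) {l : ℝ}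
    (hl : |l| ≤ 1) (n : ℕ) :
    ∫⁻ ω, ENNReal.ofReal (Real.exp (l * ∑ t ∈ Finset.range n, D t ω (ω t)))
      ∂(Measure.infinitePi fun _ : ℕ => ν) ≤ ENNReal.ofReal (Real.exp (l ^ 2 * n)) := by
  induction n with
  | zero => simp
  | succ n ih =>
    have hexp : Measurable fun ω : ℕ → X =>
        ENNReal.ofReal (Real.exp (l * ∑ t ∈ Finset.range (n + 1), D t ω (ω t))) :=
      (Real.measurable_exp.comp ((h.measurable_sum (n + 1)).const_mul l)).ennreal_ofReal
    have hsplit : ∀ (ω : ℕ → X) (x : X),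
        ENNReal.ofReal (Real.exp (l * ∑ t ∈ Finset.range (n + 1),
          D t (Function.update ω n x) (Function.update ω n x t))) =
        ENNReal.ofReal (Real.exp (l * ∑ t ∈ Finset.range n, D t ω (ω t))) *
          ENNReal.ofReal (Real.exp (l * D n ω x)) := fun ω x => by
      rw [← ENNReal.ofReal_mul (Real.exp_nonneg _), ← Real.exp_add, ← mul_add,
        Finset.sum_range_succ, h.update n n le_rfl, Function.update_self]
      congr 4
      refine Finset.sum_congr rfl fun t ht => ?_
      have ht' := Finset.mem_range.1 ht
      rw [h.update t n ht'.le, Function.update_of_ne ht'.ne]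
    rw [← (measurePreserving_update ν n).lintegral_comp hexp,
      lintegral_prod (fun p : (ℕ → X) × X => ENNReal.ofReal (Real.exp (l *
        ∑ t ∈ Finset.range (n + 1), D t (Function.update p.1 n p.2) (Function.update p.1 n p.2 t))))
        (hexp.comp (measurePreserving_update ν n).measurable).aemeasurable]
    calc _ = ∫⁻ ω, ENNReal.ofReal (Real.exp (l * ∑ t ∈ Finset.range n, D t ω (ω t))) *
          ∫⁻ x, ENNReal.ofReal (Real.exp (l * D n ω x)) ∂ν
            ∂(Measure.infinitePi fun _ : ℕ => ν) := by
          refine lintegral_congr fun ω => ?_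
          simp only [hsplit]
          exact lintegral_const_mul' _ _ ENNReal.ofReal_ne_top
      _ ≤ ∫⁻ ω, ENNReal.ofReal (Real.exp (l * ∑ t ∈ Finset.range n, D t ω (ω t))) *
          ENNReal.ofReal (Real.exp (l ^ 2)) ∂(Measure.infinitePi fun _ : ℕ => ν) := by
          refine lintegral_mono fun ω => mul_le_mul_right (lintegral_exp_le_of_centered ν
            ((h.measurable n).comp measurable_prodMk_left) (h.abs_le n ω) (h.integral_eq n ω) hl) _
      _ ≤ ENNReal.ofReal (Real.exp (l ^ 2 * n)) * ENNReal.ofReal (Real.exp (l ^ 2)) := by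
          rw [lintegral_mul_const' _ _ ENNReal.ofReal_ne_top]
          gcongr
      _ = _ := by
          rw [← ENNReal.ofReal_mul (Real.exp_nonneg _), ← Real.exp_add]
          congr 2; push_cast; ring

theorem measure_sum_gt_le [IsProbabilityMeasure ν] (h : IsCenteredIncrement ν D) {ε : ℝ}
    (hε : 0 < ε) (hε1 : ε ≤ 1) (n : ℕ) :
    (Measure.infinitePi fun _ : ℕ => ν) {ω | ε * n < ∑ t ∈ Finset.range n, D t ω (ω t)} ≤
      ENNReal.ofReal (Real.exp (-(ε ^ 2 / 4) * n)) := by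
  have hexp : Measurable fun ω : ℕ → X =>
      ENNReal.ofReal (Real.exp (ε / 2 * ∑ t ∈ Finset.range n, D t ω (ω t))) :=
    (Real.measurable_exp.comp ((h.measurable_sum n).const_mul _)).ennreal_ofReal
  have hsub : {ω | ε * n < ∑ t ∈ Finset.range n, D t ω (ω t)} ⊆
      {ω | ENNReal.ofReal (Real.exp (ε / 2 * (ε * n))) ≤
        ENNReal.ofReal (Real.exp (ε / 2 * ∑ t ∈ Finset.range n, D t ω (ω t)))} := fun ω hω => by
    have hω' : ε * n < ∑ t ∈ Finset.range n, D t ω (ω t) := hω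
    simp only [mem_ofPred_eq]
    gcongr
  refine (measure_mono hsub).trans ((meas_ge_le_lintegral_div hexp.aemeasurable
    (by simp [Real.exp_pos]) ENNReal.ofReal_ne_top).trans ?_)
  refine (ENNReal.div_le_div_right (h.lintegral_exp_sum_le (l := ε / 2)
    (by rw [abs_of_pos (by positivity)]; linarith) n) _).trans ?_
  rw [← ENNReal.ofReal_div_of_pos (Real.exp_pos _), ← Real.exp_sub]
  refine ENNReal.ofReal_le_ofReal (Real.exp_le_exp.2 ?_)
  apply le_of_eq; ring

/-- A martingale with bounded increments is at most `ε n`, up to a random constant with finite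
expectation: the probabilities that the bound `ε n` fails are summable against `n`. -/
theorem exists_abs_sum_le [IsProbabilityMeasure ν] (h : IsCenteredIncrement ν D) {ε : ℝ}
    (hε : 0 < ε) :
    ∃ N : (ℕ → X) → ℝ≥0, HasFiniteMean (Measure.infinitePi fun _ : ℕ => ν) N ∧
      ∀ᵐ ω ∂(Measure.infinitePi fun _ : ℕ => ν), ∀ n : ℕ,
        |∑ t ∈ Finset.range n, D t ω (ω t)| ≤ ε * n + N ω := by
  -- the exponential moment bound, used with `l = ε / 2`, needs `l ≤ 1`
  wlog hε1 : ε ≤ 1 generalizing ε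
  · obtain ⟨N, hN, hb⟩ := this one_pos le_rfl
    refine ⟨N, hN, hb.mono fun ω hω n => (hω n).trans ?_⟩
    have : (n : ℝ) ≤ ε * n := le_mul_of_one_le_left (by positivity) (le_of_not_ge hε1)
    linarith
  set P := Measure.infinitePi fun _ : ℕ => ν with hP
  set bad : ℕ → Set (ℕ → X) := fun n => {ω | ε * n < |∑ t ∈ Finset.range n, D t ω (ω t)|}
  have hbad : ∀ n, MeasurableSet (bad n) := fun n =>
    measurableSet_lt measurable_const (h.measurable_sum n).abs
  have hPbad : ∀ n, P (bad n) ≤ 2 * ENNReal.ofReal (Real.exp (-(ε ^ 2 / 4) * n)) := fun n => by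
    have hsub : bad n ⊆ {ω | ε * n < ∑ t ∈ Finset.range n, D t ω (ω t)} ∪
        {ω | ε * n < ∑ t ∈ Finset.range n, -D t ω (ω t)} := fun ω hω => by
      have hω' : ε * n < |∑ t ∈ Finset.range n, D t ω (ω t)| := hω
      simpa [lt_abs] using hω'
    refine (measure_mono hsub).trans ((measure_union_le _ _).trans ?_)
    rw [two_mul]
    exact add_le_add (h.measure_sum_gt_le hε hε1 n) (h.neg.measure_sum_gt_le hε hε1 n)
  -- `Y` is the sum of all `n` at which the bound fails, hence at least the last of them
  set Y : (ℕ → X) → ℝ≥0∞ := fun ω => ∑' n : ℕ, (bad n).indicator (fun _ => (n : ℝ≥0∞)) ω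
  have hY : Measurable Y := Measurable.tsum fun n => measurable_const.indicator (hbad n)
  have hint : ∫⁻ ω, Y ω ∂P < ∞ := by
    have hsum : Summable fun n : ℕ => (n : ℝ) ^ 1 * Real.exp (-(ε ^ 2 / 4) * n) := by
      have := Real.summable_pow_mul_exp_neg_nat_mul 1 (show 0 < ε ^ 2 / 4 by positivity)
      simpa using this
    calc ∫⁻ ω, Y ω ∂P = ∑' n : ℕ, (n : ℝ≥0∞) * P (bad n) := by
          rw [lintegral_tsum fun n => (measurable_const.indicator (hbad n)).aemeasurable]
          exact tsum_congr fun n => lintegral_indicator_const (hbad n) _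
      _ ≤ ∑' n : ℕ, 2 * ENNReal.ofReal ((n : ℝ) ^ 1 * Real.exp (-(ε ^ 2 / 4) * n)) := by
          refine ENNReal.tsum_le_tsum fun n => ?_
          rw [ENNReal.ofReal_mul (by positivity), pow_one, ENNReal.ofReal_natCast,
            mul_left_comm]
          exact mul_le_mul_right (hPbad n) _
      _ < ∞ := by
          rw [ENNReal.tsum_mul_left]
          exact ENNReal.mul_lt_top (by simp) hsum.tsum_ofReal_lt_top
  have hfin : ∀ᵐ ω ∂P, Y ω < ∞ := ae_lt_top hY hint.ne
  refine ⟨fun ω => (Y ω).toNNReal, ⟨hY.ennreal_toNNReal, ?_⟩, hfin.mono fun ω hω n => ?_⟩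
  · exact (lintegral_mono fun ω => ENNReal.coe_toNNReal_le_self).trans_lt hint
  · by_cases hb : ω ∈ bad n
    · have h1 : (n : ℝ≥0∞) ≤ Y ω := by
        refine le_trans ?_ (ENNReal.le_tsum n)
        simp [hb]
      have h2 : (n : ℝ) ≤ (Y ω).toNNReal := by
        simpa [ENNReal.coe_toNNReal_eq_toReal] using ENNReal.toReal_mono hω.ne h1
      have h3 : |∑ t ∈ Finset.range n, D t ω (ω t)| ≤ n := by
        refine (Finset.abs_sum_le_sum_abs _ _).trans ?_
        refine (Finset.sum_le_sum fun t _ => h.abs_le t ω (ω t)).trans ?_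
        simp
      have : 0 ≤ ε * n := by positivity
      linarith
    · have h1 : |∑ t ∈ Finset.range n, D t ω (ω t)| ≤ ε * n := not_lt.1 hb
      linarith [((Y ω).toNNReal).coe_nonneg]

end IsCenteredIncrement

end Concentration

/-! ### Conditional pull probabilities -/

section PullProbabilities

variable {K : ℕ} {𝒰 : Type*} [MeasurableSpace 𝒰] (A : Mechanism K 𝒰) (β : ℝ)

theorem measurable_select (n : ℕ) :
    Measurable fun p : History K 𝒰 n × 𝒰 × unitInterval => select A β n p.1 p.2.1 p.2.2 := by
  unfold select
  by_cases hn : n < K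
  · simp only [hn, dite_true]; exact measurable_const
  · simp only [hn, dite_false]
    have hpair : Measurable fun p : History K 𝒰 n × 𝒰 × unitInterval => (p.1, p.2.1) :=
      measurable_fst.prodMk (measurable_fst.comp measurable_snd)
    refine Measurable.ite ?_ ((A.measurable_leader n).comp hpair)
      ((A.measurable_challenger n).comp hpair)
    exact measurableSet_lt (measurable_subtype_coe.comp (measurable_snd.comp measurable_snd))
      measurable_const

theorem measurable_arm_of_measurable_hist {n : ℕ}
    (h : Measurable fun ω : Sample K 𝒰 => hist A β ω n) :
    Measurable fun ω : Sample K 𝒰 => arm A β ω n := by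
  have hω : Measurable fun ω : Sample K 𝒰 => ω n := measurable_pi_apply n
  exact (measurable_select A β n).comp
    (h.prodMk (hω.fst.prodMk hω.snd.fst))

theorem measurable_hist (n : ℕ) : Measurable fun ω : Sample K 𝒰 => hist A β ω n := by
  induction n with
  | zero => exact measurable_pi_lambda _ fun i => i.elim0
  | succ n ih =>
    have hω : Measurable fun ω : Sample K 𝒰 => ω n := measurable_pi_apply n
    have harm := measurable_arm_of_measurable_hist A β ih
    have hrew : Measurable fun ω : Sample K 𝒰 => (ω n).2.2 (arm A β ω n) := by
      have : Measurable fun p : (Fin K → ℝ) × Fin K => p.1 p.2 :=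
        measurable_from_prod_countable_left fun k => measurable_pi_apply k
      exact this.comp (hω.snd.snd.prodMk harm)
    refine measurable_pi_lambda _ fun i => ?_
    refine Fin.lastCases ?_ (fun j => ?_) i
    · simp only [hist, Fin.snoc_last]
      exact hω.fst.prodMk (hω.snd.fst.prodMk (harm.prodMk hrew))
    · simp only [hist, Fin.snoc_castSucc]
      exact (measurable_pi_apply j).comp ih

/-- The history of the first `n` rounds does not depend on later randomness. -/
theorem hist_update {n m : ℕ} (hnm : n ≤ m) (ω : Sample K 𝒰)
    (x : 𝒰 × unitInterval × (Fin K → ℝ)) :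
    hist A β (Function.update ω m x) n = hist A β ω n := by
  induction n with
  | zero => rfl
  | succ n ih =>
    have hne : n ≠ m := by omega
    simp only [hist, ih (by omega), Function.update_of_ne hne]

theorem measurable_pullProb (n : ℕ) (k : Fin K) :
    Measurable fun ω : Sample K 𝒰 => pullProb A β ω n k := by
  have hs : MeasurableSet {p : History K 𝒰 n × 𝒰 × unitInterval |
      select A β n p.1 p.2.1 p.2.2 = k} :=
    measurable_select A β n (measurableSet_singleton k)
  exact (((measurable_measure_prodMk_left
    (ν := (A.seedLaw : Measure 𝒰).prod (volume : Measure unitInterval)) hs).ennreal_toReal).comp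
      (measurable_hist A β n))

theorem pullProb_nonneg (ω : Sample K 𝒰) (n : ℕ) (k : Fin K) : 0 ≤ pullProb A β ω n k :=
  measureReal_nonneg

theorem pullProb_le_one (ω : Sample K 𝒰) (n : ℕ) (k : Fin K) : pullProb A β ω n k ≤ 1 :=
  measureReal_le_one

/-- The law of what is drawn in one round. -/
noncomputable abbrev roundLaw (F : Fin K → ProbabilityMeasure ℝ) :
    Measure (𝒰 × unitInterval × (Fin K → ℝ)) :=
  (A.seedLaw : Measure 𝒰).prod
    ((volume : Measure unitInterval).prod (Measure.pi fun i => (F i : Measure ℝ)))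

theorem measurableSet_select (n : ℕ) (h : History K 𝒰 n) (k : Fin K) :
    MeasurableSet {p : 𝒰 × unitInterval | select A β n h p.1 p.2 = k} :=
  ((measurable_select A β n).comp measurable_prodMk_left) (measurableSet_singleton k)

theorem roundLaw_real_select (F : Fin K → ProbabilityMeasure ℝ) (ω : Sample K 𝒰) (n : ℕ)
    (k : Fin K) :
    (roundLaw A F).real {x | select A β n (hist A β ω n) x.1 x.2.1 = k} = pullProb A β ω n k := by
  have hmap : (roundLaw A F).map (Prod.map id Prod.fst) =
      (A.seedLaw : Measure 𝒰).prod (volume : Measure unitInterval) := by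
    rw [← Measure.map_prod_map _ _ measurable_id measurable_fst, Measure.map_id,
      ← Measure.fst, Measure.fst_prod]
  rw [pullProb, ← hmap, map_measureReal_apply (measurable_id.prodMap measurable_fst)
    (measurableSet_select A β n _ k)]
  rfl

theorem isCenteredIncrement_pull (F : Fin K → ProbabilityMeasure ℝ) (k : Fin K) :
    IsCenteredIncrement (roundLaw A F) fun n ω x =>
      {x : 𝒰 × unitInterval × (Fin K → ℝ) |
        select A β n (hist A β ω n) x.1 x.2.1 = k}.indicator (fun _ => (1 : ℝ)) x -
          pullProb A β ω n k where
  measurable n := by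
    refine Measurable.sub ?_ ((measurable_pullProb A β n k).comp measurable_fst)
    have hs : MeasurableSet {p : Sample K 𝒰 × 𝒰 × unitInterval × (Fin K → ℝ) |
        select A β n (hist A β p.1 n) p.2.1 p.2.2.1 = k} :=
      ((measurable_select A β n).comp (((measurable_hist A β n).comp measurable_fst).prodMk
        (measurable_snd.fst.prodMk measurable_snd.snd.fst))) (measurableSet_singleton k)
    exact (measurable_const (a := (1 : ℝ))).indicator hs
  update n m hnm ω x := by simp only [pullProb, hist_update A β hnm]
  abs_le n ω x := by
    have h0 := pullProb_nonneg A β ω n k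
    have h1 := pullProb_le_one A β ω n k
    rw [abs_le]
    by_cases hx : x ∈ {x : 𝒰 × unitInterval × (Fin K → ℝ) |
        select A β n (hist A β ω n) x.1 x.2.1 = k}
    · rw [indicator_of_mem hx]; constructor <;> linarith
    · rw [indicator_of_notMem hx]; constructor <;> linarith
  integral_eq n ω := by
    have hs : MeasurableSet {x : 𝒰 × unitInterval × (Fin K → ℝ) |
        select A β n (hist A β ω n) x.1 x.2.1 = k} :=
      (measurable_id.prodMap measurable_fst) (measurableSet_select A β n (hist A β ω n) k)
    rw [integral_sub ((integrable_const _).indicator hs) (integrable_const _),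
      integral_indicator_const _ hs, roundLaw_real_select]
    simp

/-- The difference between the pull count and its compensator is a martingale. -/
theorem numPulls_sub_cumPullProb (ω : Sample K 𝒰) (n : ℕ) (k : Fin K) :
    (numPulls A β ω n k : ℝ) - cumPullProb A β ω n k = ∑ t ∈ Finset.range n,
      ({x : 𝒰 × unitInterval × (Fin K → ℝ) |
        select A β t (hist A β ω t) x.1 x.2.1 = k}.indicator (fun _ => (1 : ℝ)) (ω t) -
          pullProb A β ω t k) := by
  rw [Finset.sum_sub_distrib, cumPullProb, numPulls, pulls, Finset.card_filter]
  push_cast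
  congr 1
  refine Finset.sum_congr rfl fun t _ => ?_
  simp only [indicator_apply, arm, mem_ofPred_eq]
  congr

/-- The pull counts stay close to the sums of the conditional pull probabilities. -/
theorem exists_abs_numPulls_sub_le (F : Fin K → ProbabilityMeasure ℝ) {ε : ℝ} (hε : 0 < ε) :
    ∃ N : Sample K 𝒰 → ℝ≥0, HasFiniteMean (law A F) N ∧
      ∀ᵐ ω ∂(law A F), ∀ (n : ℕ) (k : Fin K),
        |(numPulls A β ω n k : ℝ) - cumPullProb A β ω n k| ≤ ε * n + N ω := by
  choose N hN hb using fun k => (isCenteredIncrement_pull A β F k).exists_abs_sum_le hε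
  refine ⟨fun ω => ∑ k, N k ω, HasFiniteMean.sum fun k _ => hN k, ?_⟩
  filter_upwards [ae_all_iff.2 hb] with ω hω n k
  rw [numPulls_sub_cumPullProb]
  refine (hω k n).trans ?_
  gcongr
  exact Finset.single_le_sum (f := fun k => N k ω) (fun _ _ => zero_le) (Finset.mem_univ k)

theorem sum_pullProb (ω : Sample K 𝒰) (n : ℕ) : ∑ k, pullProb A β ω n k = 1 := by
  have h := sum_measureReal_preimage_singleton
    (μ := (A.seedLaw : Measure 𝒰).prod (volume : Measure unitInterval))
    (f := fun p : 𝒰 × unitInterval => select A β n (hist A β ω n) p.1 p.2) Finset.univ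
    (fun k _ => measurableSet_select A β n (hist A β ω n) k)
  simpa [pullProb, preimage] using h

theorem sum_cumPullProb (ω : Sample K 𝒰) (n : ℕ) : ∑ k, cumPullProb A β ω n k = n := by
  simp only [cumPullProb]
  rw [Finset.sum_comm]
  simp [sum_pullProb]

theorem sum_numPulls (ω : Sample K 𝒰) (n : ℕ) : ∑ k, numPulls A β ω n k = n := by
  have h := Finset.card_eq_sum_card_fiberwise (s := Finset.range n) (t := Finset.univ)
    (f := fun t => arm A β ω t) (fun _ _ => by simp)
  simpa [numPulls, pulls] using h.symm

theorem numPulls_mono (ω : Sample K 𝒰) {n m : ℕ} (h : n ≤ m) (k : Fin K) :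
    numPulls A β ω n k ≤ numPulls A β ω m k :=
  Finset.card_le_card (Finset.filter_subset_filter _ (Finset.range_mono h))

/-- The conditional probability, given the first `n` rounds, that arm `k` is the challenger of
round `n + 1`. -/
noncomputable def challengerMarginal (ω : Sample K 𝒰) (n : ℕ) (k : Fin K) : ℝ :=
  (A.seedLaw : Measure 𝒰).real {u | A.challenger n (hist A β ω n) u = k}

theorem measurableSet_leader (n : ℕ) (h : History K 𝒰 n) (k : Fin K) :
    MeasurableSet {u | A.leader n h u = k} :=
  ((A.measurable_leader n).comp measurable_prodMk_left) (measurableSet_singleton k)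

theorem measurableSet_challenger (n : ℕ) (h : History K 𝒰 n) (k : Fin K) :
    MeasurableSet {u | A.challenger n h u = k} :=
  ((A.measurable_challenger n).comp measurable_prodMk_left) (measurableSet_singleton k)

variable {β}

theorem volume_real_coin_lt (hβ : β ∈ Ioo (0 : ℝ) 1) :
    (volume : Measure unitInterval).real {v | (v : ℝ) < β} = β := by
  have h : {v : unitInterval | (v : ℝ) < β} = Iio ⟨β, hβ.1.le, hβ.2.le⟩ := rfl
  rw [h, measureReal_def, unitInterval.volume_Iio]
  simp [hβ.1.le]

theorem pullProb_eq (hβ : β ∈ Ioo (0 : ℝ) 1) (ω : Sample K 𝒰) {n : ℕ} (hn : K ≤ n) (k : Fin K) :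
    pullProb A β ω n k =
      β * leaderProb A β ω n k + (1 - β) * challengerMarginal A β ω n k := by
  have hset : {p : 𝒰 × unitInterval | select A β n (hist A β ω n) p.1 p.2 = k} =
      {u | A.leader n (hist A β ω n) u = k} ×ˢ {v : unitInterval | (v : ℝ) < β} ∪
      {u | A.challenger n (hist A β ω n) u = k} ×ˢ {v : unitInterval | (v : ℝ) < β}ᶜ := by
    ext ⟨u, v⟩
    by_cases hv : (v : ℝ) < β <;> simp [select, not_lt.2 hn, hv]
  have hcoin : MeasurableSet {v : unitInterval | (v : ℝ) < β} :=
    measurableSet_lt measurable_subtype_coe measurable_const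
  have hdisj : Disjoint
      ({u | A.leader n (hist A β ω n) u = k} ×ˢ {v : unitInterval | (v : ℝ) < β})
      ({u | A.challenger n (hist A β ω n) u = k} ×ˢ {v : unitInterval | (v : ℝ) < β}ᶜ) :=
    Set.disjoint_prod.2 (Or.inr disjoint_compl_right)
  rw [pullProb, hset, measureReal_union hdisj ((measurableSet_challenger A n _ k).prod hcoin.compl),
    measureReal_prod_prod, measureReal_prod_prod, probReal_compl_eq_one_sub hcoin,
    volume_real_coin_lt hβ]
  simp only [leaderProb, challengerMarginal]
  ring

theorem leaderProb_mul_challengerProb (ω : Sample K 𝒰) (n : ℕ) (j k : Fin K) :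
    leaderProb A β ω n j * challengerProb A β ω n j k = (A.seedLaw : Measure 𝒰).real
      ({u | A.leader n (hist A β ω n) u = j} ∩ {u | A.challenger n (hist A β ω n) u = k}) := by
  rw [leaderProb, challengerProb, measureReal_def, measureReal_def, measureReal_def,
    ← ENNReal.toReal_mul, mul_comm, cond_mul_eq_inter (measurableSet_leader A n _ j)]

theorem leaderProb_nonneg (ω : Sample K 𝒰) (n : ℕ) (k : Fin K) : 0 ≤ leaderProb A β ω n k :=
  measureReal_nonneg

theorem challengerMarginal_nonneg (ω : Sample K 𝒰) (n : ℕ) (k : Fin K) :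
    0 ≤ challengerMarginal A β ω n k :=
  measureReal_nonneg

/-- The most likely value of a random arm has probability at least `1 / K`. -/
theorem one_div_le_of_forall_le {f : Fin K → ℝ} (hf : ∑ k, f k = 1) {k₀ : Fin K}
    (h : ∀ k, f k ≤ f k₀) : 1 / (K : ℝ) ≤ f k₀ := by
  have hK : (0 : ℝ) < K := Nat.cast_pos.2 (Fin.pos k₀)
  rw [div_le_iff₀ hK, ← hf]
  refine (Finset.sum_le_sum fun k _ => h k).trans ?_
  simp [mul_comm]

theorem one_div_le_leaderProb {B : ℕ → Sample K 𝒰 → Fin K} (hB : IsEffectiveLeader A β B)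
    (ω : Sample K 𝒰) {n : ℕ} (hn : K ≤ n) : 1 / (K : ℝ) ≤ leaderProb A β ω n (B n ω) := by
  refine one_div_le_of_forall_le ?_ (hB n hn ω)
  have h := sum_measureReal_preimage_singleton (μ := (A.seedLaw : Measure 𝒰))
    (f := A.leader n (hist A β ω n)) Finset.univ (fun k _ => measurableSet_leader A n _ k)
  simpa [leaderProb, preimage] using h

theorem one_div_le_challengerProb {B C : ℕ → Sample K 𝒰 → Fin K} (hB : IsEffectiveLeader A β B)
    (hC : IsEffectiveChallenger A β B C) (ω : Sample K 𝒰) {n : ℕ} (hn : K ≤ n) :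
    1 / (K : ℝ) ≤ challengerProb A β ω n (B n ω) (C n ω) := by
  have hK : (0 : ℝ) < K := Nat.cast_pos.2 (Fin.pos (B n ω))
  have hpos : 0 < leaderProb A β ω n (B n ω) :=
    lt_of_lt_of_le (by positivity) (one_div_le_leaderProb A hB ω hn)
  have hne : (A.seedLaw : Measure 𝒰) {u | A.leader n (hist A β ω n) u = B n ω} ≠ 0 := fun h0 => by
    rw [leaderProb, measureReal_def, h0] at hpos
    simp at hpos
  have hprob := cond_isProbabilityMeasure hne
  refine one_div_le_of_forall_le ?_ fun k => ?_
  · have h := sum_measureReal_preimage_singleton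
      (μ := (A.seedLaw : Measure 𝒰)[|{u | A.leader n (hist A β ω n) u = B n ω}])
      (f := A.challenger n (hist A β ω n)) Finset.univ
      (fun k _ => measurableSet_challenger A n _ k)
    simpa [challengerProb, preimage] using h
  · by_cases hk : k = B n ω
    · have hz : leaderProb A β ω n (B n ω) * challengerProb A β ω n (B n ω) k = 0 := by
        rw [leaderProb_mul_challengerProb]
        convert measureReal_empty
        ext u
        simp only [mem_inter_iff, mem_ofPred_eq, mem_empty_iff_false, iff_false, not_and]
        exact fun h1 h2 => A.challenger_ne_leader n _ u (by rw [h1, h2, hk])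
      rw [(mul_eq_zero.1 hz).resolve_left hpos.ne']
      exact measureReal_nonneg
    · exact (hC n hn ω).2 k hk

theorem le_pullProb_leader (hβ : β ∈ Ioo (0 : ℝ) 1) {B : ℕ → Sample K 𝒰 → Fin K}
    (hB : IsEffectiveLeader A β B) (ω : Sample K 𝒰) {n : ℕ} (hn : K ≤ n) :
    β / K ≤ pullProb A β ω n (B n ω) := by
  rw [pullProb_eq A hβ ω hn]
  have h1 := mul_le_mul_of_nonneg_left (one_div_le_leaderProb A hB ω hn) hβ.1.le
  have h2 := mul_nonneg (sub_nonneg.2 hβ.2.le) (challengerMarginal_nonneg A ω n (B n ω) (β := β))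
  have h3 : β / K = β * (1 / K) := by ring
  linarith

theorem le_pullProb_challenger (hβ : β ∈ Ioo (0 : ℝ) 1) {B C : ℕ → Sample K 𝒰 → Fin K}
    (hB : IsEffectiveLeader A β B) (hC : IsEffectiveChallenger A β B C) (ω : Sample K 𝒰) {n : ℕ}
    (hn : K ≤ n) : (1 - β) / K ^ 2 ≤ pullProb A β ω n (C n ω) := by
  rw [pullProb_eq A hβ ω hn]
  have h1 : (1 / (K : ℝ)) * (1 / K) ≤ challengerMarginal A β ω n (C n ω) := by
    refine (mul_le_mul (one_div_le_leaderProb A hB ω hn) (one_div_le_challengerProb A hB hC ω hn)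
      (by positivity) (leaderProb_nonneg A ω n _)).trans ?_
    rw [leaderProb_mul_challengerProb]
    exact measureReal_mono inter_subset_right
  have h2 := mul_le_mul_of_nonneg_left h1 (sub_nonneg.2 hβ.2.le)
  have h3 := mul_nonneg hβ.1.le (leaderProb_nonneg A ω n (C n ω) (β := β))
  have h4 : (1 - β) / (K : ℝ) ^ 2 = (1 - β) * (1 / K * (1 / K)) := by
    rw [one_div, ← mul_inv, ← sq, div_eq_mul_inv]
  linarith

/-- A challenger differs from its leader, so arm `i` can only be pulled as a challenger when it is
not the leader. -/
theorem pullProb_leader_le (hβ : β ∈ Ioo (0 : ℝ) 1) (ω : Sample K 𝒰) {n : ℕ} (hn : K ≤ n)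
    (i : Fin K) : pullProb A β ω n i ≤
      β + (A.seedLaw : Measure 𝒰).real {u | A.leader n (hist A β ω n) u ≠ i} := by
  rw [pullProb_eq A hβ ω hn]
  have h1 : leaderProb A β ω n i ≤ 1 := measureReal_le_one
  have h2 : challengerMarginal A β ω n i ≤
      (A.seedLaw : Measure 𝒰).real {u | A.leader n (hist A β ω n) u ≠ i} :=
    measureReal_mono fun u hu hu' => A.challenger_ne_leader n _ u (by
      rw [hu', show A.challenger n _ u = i from hu])
  nlinarith [hβ.1, hβ.2, challengerMarginal_nonneg A ω n i (β := β)]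

theorem pullProb_le_of_ne (hβ : β ∈ Ioo (0 : ℝ) 1) (ω : Sample K 𝒰) {n : ℕ} (hn : K ≤ n)
    {i k : Fin K} (hk : k ≠ i) : pullProb A β ω n k ≤
      2 * (A.seedLaw : Measure 𝒰).real {u | A.leader n (hist A β ω n) u ≠ i} +
        challengerProb A β ω n i k := by
  rw [pullProb_eq A hβ ω hn]
  set q := (A.seedLaw : Measure 𝒰).real {u | A.leader n (hist A β ω n) u ≠ i} with hq
  have hq0 : 0 ≤ q := measureReal_nonneg
  have h1 : leaderProb A β ω n k ≤ q :=
    measureReal_mono fun u hu hu' => hk (by rw [← show A.leader n _ u = k from hu, hu'])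
  have hc0 : 0 ≤ challengerProb A β ω n i k := measureReal_nonneg
  have h2 : challengerMarginal A β ω n k ≤ q + challengerProb A β ω n i k := by
    have hsub : {u | A.challenger n (hist A β ω n) u = k} ⊆
        {u | A.leader n (hist A β ω n) u ≠ i} ∪
          ({u | A.leader n (hist A β ω n) u = i} ∩ {u | A.challenger n (hist A β ω n) u = k}) := by
      intro u hu
      by_cases h : A.leader n (hist A β ω n) u = i
      · exact Or.inr ⟨h, hu⟩
      · exact Or.inl h
    refine (measureReal_mono hsub).trans ((measureReal_union_le _ _).trans ?_)
    rw [← leaderProb_mul_challengerProb]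
    have h3 : leaderProb A β ω n i ≤ 1 := measureReal_le_one
    exact add_le_add le_rfl (mul_le_of_le_one_left hc0 h3)
  have h4 := mul_le_mul_of_nonneg_left h1 hβ.1.le
  have h5 := mul_le_mul_of_nonneg_left h2 (sub_nonneg.2 hβ.2.le)
  nlinarith [hβ.1, hβ.2, mul_nonneg hβ.1.le hc0, mul_nonneg hβ.1.le hq0,
    mul_nonneg (sub_nonneg.2 hβ.2.le) hq0]

end PullProbabilities

/-! ### Exploration -/

theorem exists_forall_rpow_le_mul {a η : ℝ} (ha : a < 1) (hη : 0 < η) :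
    ∃ D : ℝ≥0, 0 < D ∧ ∀ x : ℝ, (D : ℝ) ≤ x → x ^ a ≤ η * x := by
  have h := (tendsto_rpow_neg_atTop (sub_pos.2 ha)).eventually_le_const hη
  obtain ⟨D, hD⟩ := eventually_atTop.1 h
  refine ⟨max D.toNNReal 1, by positivity, fun x hx => ?_⟩
  rw [NNReal.coe_max, max_le_iff] at hx
  have hx1 : (1 : ℝ) ≤ x := by simpa using hx.2
  have hx0 : 0 < x := by linarith
  calc x ^ a = x ^ (-(1 - a)) * x := by
        rw [← Real.rpow_add_one hx0.ne']; congr 1; ring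
    _ ≤ η * x := by
        gcongr
        exact hD x ((Real.le_coe_toNNReal D).trans hx.1)

section Exploration

variable {K : ℕ} {𝒰 : Type*} [MeasurableSpace 𝒰] {A : Mechanism K 𝒰} {β : ℝ}
  {F : Fin K → ProbabilityMeasure ℝ} {B C : ℕ → Sample K 𝒰 → Fin K}

instance isProbabilityMeasure_law (A : Mechanism K 𝒰) (F : Fin K → ProbabilityMeasure ℝ) :
    IsProbabilityMeasure (law A F) := by
  unfold law; infer_instance

theorem cumPullProb_succ (ω : Sample K 𝒰) (n : ℕ) (k : Fin K) :
    cumPullProb A β ω (n + 1) k = cumPullProb A β ω n k + pullProb A β ω n k :=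
  Finset.sum_range_succ _ _

/-- While an arm has fewer than `x` pulls, its cumulative pull probability cannot be much larger
than `x`. -/
theorem sum_pullProb_of_numPulls_lt_le {ω : Sample K 𝒰} {k : Fin K} {ε x M : ℝ} (hε : 0 ≤ ε)
    (hx : 0 ≤ x) (hM : 0 ≤ M)
    (h : ∀ n, |(numPulls A β ω n k : ℝ) - cumPullProb A β ω n k| ≤ ε * n + M) (n : ℕ) :
    ∑ t ∈ Finset.range n, (if (numPulls A β ω t k : ℝ) < x then pullProb A β ω t k else 0) ≤
      x + ε * n + M + 1 := by
  induction n with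
  | zero => simp; positivity
  | succ n ih =>
    by_cases hn : (numPulls A β ω n k : ℝ) < x
    · have hall : ∑ t ∈ Finset.range (n + 1),
          (if (numPulls A β ω t k : ℝ) < x then pullProb A β ω t k else 0) =
          cumPullProb A β ω (n + 1) k := by
        refine Finset.sum_congr rfl fun t ht => if_pos ?_
        have := numPulls_mono A β ω (Nat.lt_succ_iff.1 (Finset.mem_range.1 ht)) k
        exact lt_of_le_of_lt (by exact_mod_cast this) hn
      have h1 := (abs_le.1 (h n)).1
      have h2 := pullProb_le_one A β ω n k
      rw [hall, cumPullProb_succ]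
      push_cast
      linarith
    · rw [Finset.sum_range_succ, if_neg hn]
      push_cast
      linarith

/-- As long as some arm is highly under-sampled, the effective leader or the effective challenger is
mildly under-sampled: otherwise both would be the best of the arms that are not. -/
theorem exists_mem_mildlyUnder (hdistinct : ∀ i j, i ≠ j → mean (F i) ≠ mean (F j))
    {ω : Sample K 𝒰} {n : ℕ} {L : ℝ}
    (h1 : (sampledEnough A β ω n (L ^ (3 / 4 : ℝ))).Nonempty →
      B n ω ∈ sampledEnough A β ω n (L ^ (3 / 4 : ℝ)) →
        B n ω ∈ bestIn F (sampledEnough A β ω n (L ^ (3 / 4 : ℝ))))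
    (h2 : B n ω ∉ mildlyUnder A β ω n L →
      C n ω ∈ mildlyUnder A β ω n L ∪ (bestIn F (mildlyUnder A β ω n L)ᶜ \ {B n ω})) :
    B n ω ∈ mildlyUnder A β ω n L ∨ C n ω ∈ mildlyUnder A β ω n L := by
  by_cases hBV : B n ω ∈ mildlyUnder A β ω n L
  · exact Or.inl hBV
  refine Or.inr ((h2 hBV).resolve_right fun hCb => ?_)
  have hcompl : (mildlyUnder A β ω n L)ᶜ = sampledEnough A β ω n (L ^ (3 / 4 : ℝ)) := by
    ext i; simp [mildlyUnder, sampledEnough]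
  rw [← hcompl] at h1
  have hb := h1 ⟨_, hBV⟩ hBV
  exact hdistinct _ _ (fun h => hCb.2 h)
    (le_antisymm (hb.2 _ hCb.1.1) (hCb.1.2 _ hb.1))

/-- The exploration properties of leader and challenger imply sufficient exploration. If an arm had
fewer than `√(n / K)` pulls, then in each of the first `n` rounds an arm with fewer than
`(n / K)^(3/4)` pulls would be pulled with conditional probability bounded from below, although
such arms have a cumulative pull probability `o(n)`. -/
theorem sufficientExploration (hβ : β ∈ Ioo (0 : ℝ) 1)
    (hdistinct : ∀ i j, i ≠ j → mean (F i) ≠ mean (F j))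
    (hB : IsEffectiveLeader A β B) (hC : IsEffectiveChallenger A β B C)
    (hleader : LeaderExplores A β F B) (hchallenger : ChallengerExplores A β F B C) :
    SufficientExploration A β F := by
  obtain rfl | hKpos := K.eq_zero_or_pos
  · exact ⟨fun _ => 0, hasFiniteMean_const 0, ae_of_all _ fun ω n _ i => i.elim0⟩
  obtain ⟨L₁, hL₁, hae₁⟩ := hchallenger hleader
  obtain ⟨L₀, hL₀m, hL₀, hae₀⟩ := hleader
  have hK : (0 : ℝ) < K := Nat.cast_pos.2 hKpos
  obtain ⟨p, hp, hpB, hpC⟩ : ∃ p : ℝ, 0 < p ∧ p ≤ β / K ∧ p ≤ (1 - β) / K ^ 2 :=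
    ⟨min (β / K) ((1 - β) / K ^ 2),
      lt_min (div_pos hβ.1 hK) (div_pos (sub_pos.2 hβ.2) (by positivity)),
      min_le_left _ _, min_le_right _ _⟩
  have hε : 0 < p / (4 * K) := by positivity
  obtain ⟨N, hN, haeN⟩ := exists_abs_numPulls_sub_le A β F hε
  obtain ⟨D, hD0, hD⟩ := exists_forall_rpow_le_mul (a := 3 / 4) (by norm_num)
    (show 0 < p / 4 by positivity)
  have hL₀' : HasFiniteMean (law A F) fun ω => L₀ ω ^ (4 / 3 : ℝ) := by
    refine ⟨hL₀m.pow_const _, ?_⟩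
    have := hL₀ (4 / 3) (by norm_num)
    simpa only [ENNReal.coe_rpow_of_nonneg _ (show (0 : ℝ) ≤ 4 / 3 by norm_num)] using this
  -- `q N` and the constant `D'` exceed the terms that are not proportional to `n`
  set q : ℝ≥0 := (4 * K / p).toNNReal with hq
  set D' : ℝ≥0 := K + K * D + q * 2 with hD'
  have hqr : (q : ℝ) = 4 * K / p := Real.coe_toNNReal _ (by positivity)
  refine ⟨fun ω => (K * (L₀ ω ^ (4 / 3 : ℝ)) + K * L₁ ω) + q * N ω + D',
    (((hL₀'.const_mul K).add (hL₁.const_mul K)).add (hN.const_mul q)).add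
      (hasFiniteMean_const D'), ?_⟩
  filter_upwards [hae₀, hae₁, haeN] with ω h₀ h₁ hNω n hn i
  by_contra! hlt
  have hD'r : (D' : ℝ) = K + K * D + 4 * K / p * 2 := by rw [hD']; push_cast; rw [hqr]
  push_cast at hn
  rw [hD'r, hqr] at hn
  have e1 : (0 : ℝ) ≤ K * ((L₀ ω : ℝ) ^ (4 / 3 : ℝ)) := by positivity
  have e2 : (0 : ℝ) ≤ K * (L₁ ω : ℝ) := by positivity
  have e3 : (0 : ℝ) ≤ 4 * K / p * N ω := by positivity
  have e4 : (0 : ℝ) ≤ 4 * K / p * 2 := by positivity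
  have e5 : (0 : ℝ) < K * D := by positivity
  set L : ℝ := n / K with hL
  have hnL : (n : ℝ) = K * L := by rw [hL]; field_simp
  have hLpos : 0 < L := by
    have : 0 < (n : ℝ) := by linarith
    positivity
  have hLL₀ : (L₀ ω : ℝ) ^ (4 / 3 : ℝ) ≤ L := by
    rw [hnL] at hn; exact le_of_mul_le_mul_left (by linarith) hK
  have hLL₁ : (L₁ ω : ℝ) ≤ L := by
    rw [hnL] at hn; exact le_of_mul_le_mul_left (by linarith) hK
  have hLD : (D : ℝ) ≤ L := by
    rw [hnL] at hn; exact le_of_mul_le_mul_left (by linarith) hK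
  have hL₀L : (L₀ ω : ℝ) ≤ L ^ (3 / 4 : ℝ) := by
    have := Real.rpow_le_rpow (z := 3 / 4) (by positivity) hLL₀ (by norm_num)
    rwa [← Real.rpow_mul (by positivity), show (4 / 3 * (3 / 4) : ℝ) = 1 by norm_num,
      Real.rpow_one] at this
  set x : ℝ := L ^ (3 / 4 : ℝ) with hx
  -- in each round, an under-sampled arm is pulled with probability at least `p`
  have hround : ∀ t ∈ Finset.range n, (if t < K then 0 else p) ≤
      ∑ k, (if (numPulls A β ω t k : ℝ) < x then pullProb A β ω t k else 0) := by
    intro t ht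
    have hnonneg : ∀ k, 0 ≤
        (if (numPulls A β ω t k : ℝ) < x then pullProb A β ω t k else 0) := fun k => by
      split_ifs
      exacts [pullProb_nonneg A β ω t k, le_rfl]
    split_ifs with htK
    · exact Finset.sum_nonneg fun k _ => hnonneg k
    have htK' : K ≤ t := not_lt.1 htK
    have hU : (highlyUnder A β ω t L).Nonempty := by
      refine ⟨i, lt_of_le_of_lt ?_ hlt⟩
      exact_mod_cast numPulls_mono A β ω (Finset.mem_range.1 ht).le i
    rcases exists_mem_mildlyUnder hdistinct
      (h₀ x (Real.rpow_pos_of_pos hLpos _) hL₀L t htK')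
      (h₁ L hLpos hLL₁ t htK' hU) with hV | hV
    · refine le_trans ?_ (Finset.single_le_sum (fun k _ => hnonneg k) (Finset.mem_univ (B t ω)))
      rw [if_pos (show (numPulls A β ω t (B t ω) : ℝ) < x from hV)]
      exact hpB.trans (le_pullProb_leader A hβ hB ω htK')
    · refine le_trans ?_ (Finset.single_le_sum (fun k _ => hnonneg k) (Finset.mem_univ (C t ω)))
      rw [if_pos (show (numPulls A β ω t (C t ω) : ℝ) < x from hV)]
      exact hpC.trans (le_pullProb_challenger A hβ hB hC ω htK')
  have hlower : p * (n - K) ≤ ∑ t ∈ Finset.range n, (if t < K then 0 else p) := by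
    have hsub : ∀ m : ℕ, p * ((m : ℝ) - K) ≤ ∑ t ∈ Finset.range m, (if t < K then 0 else p) := by
      intro m
      induction m with
      | zero => simp only [Finset.range_zero, Finset.sum_empty, Nat.cast_zero]; nlinarith
      | succ m ih =>
        rw [Finset.sum_range_succ]
        split_ifs with hm
        · have : (0 : ℝ) ≤ ∑ t ∈ Finset.range m, (if t < K then 0 else p) :=
            Finset.sum_nonneg fun t _ => by split_ifs <;> linarith
          have hm' : ((m + 1 : ℕ) : ℝ) ≤ K := by exact_mod_cast hm
          nlinarith
        · push_cast; linarith
    exact hsub n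
  have hupper : ∑ t ∈ Finset.range n,
      ∑ k, (if (numPulls A β ω t k : ℝ) < x then pullProb A β ω t k else 0) ≤
        K * (x + p / (4 * K) * n + N ω + 1) := by
    rw [Finset.sum_comm]
    refine (Finset.sum_le_sum fun k _ => sum_pullProb_of_numPulls_lt_le hε.le
      (Real.rpow_nonneg hLpos.le _) (N ω).coe_nonneg (fun m => hNω m k) n).trans ?_
    rw [Finset.sum_const, Finset.card_univ, Fintype.card_fin, nsmul_eq_mul]
  have hmain : p * (n - K) ≤ K * (x + p / (4 * K) * n + N ω + 1) :=
    hlower.trans ((Finset.sum_le_sum hround).trans hupper)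
  have hKx : K * x ≤ p / 4 * n := by
    calc K * x ≤ K * (p / 4 * L) := by gcongr; exact hD L hLD
      _ = p / 4 * n := by rw [hnL]; ring
  have hKe : (K : ℝ) * (p / (4 * K) * n) = p / 4 * n := by field_simp
  have hpn : p * (4 * K / p * N ω + 4 * K / p * 2 + K) < p * n :=
    mul_lt_mul_of_pos_left (by linarith) hp
  have hpe : p * (4 * K / p * N ω + 4 * K / p * 2 + K) = 4 * K * N ω + 4 * K * 2 + p * K := by
    field_simp
  have hpK : p * K ≤ K := by
    refine mul_le_of_le_one_left hK.le (hpB.trans ?_)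
    rw [div_le_one hK]
    exact hβ.2.le.trans (by exact_mod_cast hKpos)
  have hKN : (0 : ℝ) ≤ K * N ω := by positivity
  linarith

end Exploration

/-! ### Convergence of the allocation -/

theorem PolynomialDecay.tendsto_zero {g : ℕ → ℝ} (hg : PolynomialDecay g) :
    Tendsto g atTop (𝓝 0) := by
  obtain ⟨a, ha, ho⟩ := hg.2
  exact ho.trans_tendsto ((tendsto_rpow_neg_atTop ha).comp tendsto_natCast_atTop_atTop)

theorem exists_sum_abs_le {g : ℕ → ℝ} (hg : Tendsto g atTop (𝓝 0)) {ε : ℝ} (hε : 0 < ε) :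
    ∃ D : ℝ≥0, ∀ n : ℕ, ∑ t ∈ Finset.range n, |g t| ≤ ε * n + D := by
  have h : ∀ᶠ t in atTop, |g t| ≤ ε := by
    have := hg.abs
    rw [abs_zero] at this
    exact this.eventually_le_const hε
  obtain ⟨n₀, hn₀⟩ := eventually_atTop.1 h
  refine ⟨.mk (∑ t ∈ Finset.range n₀, |g t|) (Finset.sum_nonneg fun _ _ => abs_nonneg _),
    fun n => ?_⟩
  rw [NNReal.coe_mk]
  induction n with
  | zero => simpa using Finset.sum_nonneg fun _ _ => abs_nonneg _
  | succ n ih =>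
    push_cast
    rcases lt_or_ge n n₀ with hn | hn
    · have h1 := Finset.sum_le_sum_of_subset_of_nonneg (f := fun t => |g t|)
        (Finset.range_mono (show n + 1 ≤ n₀ from hn)) fun _ _ _ => abs_nonneg _
      have : 0 ≤ ε * (n + 1 : ℝ) := by positivity
      linarith
    · rw [Finset.sum_range_succ]
      linarith [hn₀ n hn]

section Allocation

variable {K : ℕ} {𝒰 : Type*} [MeasurableSpace 𝒰] {A : Mechanism K 𝒰} {β : ℝ}
  {F : Fin K → ProbabilityMeasure ℝ}

theorem cumPullProb_le_natCast (ω : Sample K 𝒰) (n : ℕ) (k : Fin K) :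
    cumPullProb A β ω n k ≤ n := by
  refine (Finset.sum_le_sum fun t _ => pullProb_le_one A β ω t k).trans ?_
  simp

/-- If an arm is pulled with conditional probability about `w` or less whenever its average
conditional pull probability exceeds `w + ε`, then this average cannot exceed `w + ε` by much. -/
theorem cumPullProb_le_of_imp {ω : Sample K 𝒰} {k : Fin K} {w ε M : ℝ} {g : ℕ → ℝ} (hw : 0 ≤ w)
    (hε : 0 < ε) (hM : 0 ≤ M)
    (h : ∀ n : ℕ, M ≤ n → w + ε ≤ cumPullProb A β ω n k / n → pullProb A β ω n k ≤ w + g n)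
    (n : ℕ) :
    cumPullProb A β ω n k ≤ (w + ε) * n + M + 1 + ∑ t ∈ Finset.range n, |g t| := by
  induction n with
  | zero => simp [cumPullProb]; positivity
  | succ n ih =>
    have hsum : 0 ≤ ∑ t ∈ Finset.range (n + 1), |g t| := Finset.sum_nonneg fun _ _ => abs_nonneg _
    have hwn : 0 ≤ (w + ε) * n := by positivity
    have h1 := pullProb_le_one A β ω n k
    rcases lt_or_ge (n : ℝ) M with hn | hn
    · have := cumPullProb_le_natCast (A := A) (β := β) ω (n + 1) k
      push_cast at this ⊢
      linarith
    · rw [cumPullProb_succ]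
      by_cases hcond : w + ε ≤ cumPullProb A β ω n k / n
      · rw [Finset.sum_range_succ]
        push_cast
        linarith [h n hn hcond, le_abs_self (g n)]
      · have hlt : cumPullProb A β ω n k ≤ (w + ε) * n := by
          rcases n.eq_zero_or_pos with rfl | hpos
          · simp [cumPullProb]
          · have hpos' : (0 : ℝ) < n := Nat.cast_pos.2 hpos
            exact ((div_lt_iff₀ hpos').1 (not_le.1 hcond)).le
        push_cast
        linarith

variable {E : Type*} {𝓕 : Set (ProbabilityMeasure ℝ)} {T : ProbabilityMeasure ℝ → E}
  {istar : Fin K} {w : Fin K → ℝ}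

/-- The average pull probabilities are asymptotically at most the optimal weights: for the best arm
because it is the leader with high probability, for the other arms because they are rarely
challengers when they exceed their weight. -/
theorem exists_cumPullProb_le (hβ : β ∈ Ioo (0 : ℝ) 1) (hexp : SufficientExploration A β F)
    (hleader : LeaderConverges A β F istar) (hchallenger : ChallengerConverges 𝓕 T A β F istar)
    (hw : w ∈ optimalAllocations 𝓕 T β F istar) {ε : ℝ} (hε : 0 < ε) :
    ∃ N : Sample K 𝒰 → ℝ≥0, HasFiniteMean (law A F) N ∧
      ∀ᵐ ω ∂(law A F), ∀ (n : ℕ) (k : Fin K),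
        cumPullProb A β ω n k ≤ (w k + ε) * n + N ω := by
  obtain ⟨ε₀, hε₀, hch⟩ := hchallenger hexp hleader w hw
  obtain ⟨g, hg, N₂, hN₂, hae₂⟩ := hleader hexp
  have hε' : 0 < min (ε / 2) ε₀ := lt_min (by positivity) hε₀
  obtain ⟨h, hh, N₃, hN₃, hae₃⟩ := hch _ hε' (min_le_right _ _)
  have hG : Tendsto (fun t => 2 * |g t| + |h t|) atTop (𝓝 0) := by
    simpa using (hg.tendsto_zero.abs.const_mul 2).add hh.tendsto_zero.abs
  obtain ⟨D, hD⟩ := exists_sum_abs_le hG (half_pos hε)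
  refine ⟨fun ω => (N₂ ω + N₃ ω) + (K + 1 + D),
    (hN₂.add hN₃).add (hasFiniteMean_const _), ?_⟩
  filter_upwards [hae₂, hae₃] with ω h₂ h₃ n k
  have hwk : 0 ≤ w k := hw.1.1.1 k
  have hK0 : (0 : ℝ) ≤ K := by positivity
  have hN₂0 := (N₂ ω).coe_nonneg
  have hN₃0 := (N₃ ω).coe_nonneg
  have key := cumPullProb_le_of_imp (A := A) (β := β) (ω := ω) (k := k) (w := w k)
    (M := N₂ ω + N₃ ω + K) (g := fun t => 2 * |g t| + |h t|) hwk hε' (by positivity)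
    (fun m hm hcond => by
      have hKm : K ≤ m := by
        have : (K : ℝ) ≤ m := by linarith
        exact_mod_cast this
      have hlead := h₂ m hKm (by linarith)
      have hga := le_abs_self (g m)
      have hha := le_abs_self (h m)
      by_cases hk : k = istar
      · subst hk
        have hβw : w k = β := hw.1.2
        have := pullProb_leader_le A hβ ω hKm k
        linarith [abs_nonneg (h m), abs_nonneg (g m)]
      · have := pullProb_le_of_ne A hβ ω hKm hk
        linarith [h₃ m hKm (by linarith) k hk hcond]) n
  have hmin : (w k + min (ε / 2) ε₀) * n ≤ (w k + ε / 2) * n := by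
    gcongr
    exact min_le_left _ _
  push_cast
  linarith [hD n]

/-- The empirical allocation converges to the optimal allocation `w`. The upper bounds for all arms
yield the lower bounds, since both allocations sum to `1`. -/
theorem exists_abs_numPulls_sub_weight_le (hβ : β ∈ Ioo (0 : ℝ) 1)
    (hexp : SufficientExploration A β F)
    (hleader : LeaderConverges A β F istar) (hchallenger : ChallengerConverges 𝓕 T A β F istar)
    (hw : w ∈ optimalAllocations 𝓕 T β F istar) {ε : ℝ} (hε : 0 < ε) :
    ∃ N : Sample K 𝒰 → ℝ≥0, HasFiniteMean (law A F) N ∧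
      ∀ᵐ ω ∂(law A F), ∀ (n : ℕ) (k : Fin K),
        |(numPulls A β ω n k : ℝ) - w k * n| ≤ ε * n + N ω := by
  have hK : (0 : ℝ) < K := Nat.cast_pos.2 (Fin.pos istar)
  have hK1 : (1 : ℝ) ≤ K := by exact_mod_cast Fin.pos istar
  obtain ⟨N, hN, hae⟩ := exists_cumPullProb_le hβ hexp hleader hchallenger hw
    (show 0 < ε / (2 * K) by positivity)
  obtain ⟨N', hN', hae'⟩ := exists_abs_numPulls_sub_le A β F (half_pos hε)
  refine ⟨fun ω => K * N ω + N' ω, (hN.const_mul K).add hN', ?_⟩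
  filter_upwards [hae, hae'] with ω hω hω' n k
  have hslack : ∀ j, 0 ≤ (w j + ε / (2 * K)) * n + N ω - cumPullProb A β ω n j := fun j =>
    sub_nonneg.2 (hω n j)
  have hsum : ∑ j, ((w j + ε / (2 * K)) * n + N ω - cumPullProb A β ω n j) =
      ε / 2 * n + K * N ω := by
    rw [Finset.sum_sub_distrib, sum_cumPullProb, Finset.sum_add_distrib, ← Finset.sum_mul,
      Finset.sum_add_distrib, hw.1.1.2]
    simp only [Finset.sum_const, Finset.card_univ, Fintype.card_fin, nsmul_eq_mul]
    field_simp
    ring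
  have hlow := Finset.single_le_sum (fun j _ => hslack j) (Finset.mem_univ k)
  rw [hsum] at hlow
  have hup := hω n k
  have hε1 : ε / (2 * K) * n ≤ ε / 2 * n := by
    gcongr
    linarith
  have hε0 : 0 ≤ ε / (2 * K) * n := by positivity
  have hNK : (N ω : ℝ) ≤ K * N ω := le_mul_of_one_le_left (N ω).coe_nonneg hK1
  have hN0 := (N ω).coe_nonneg
  have h1 := abs_le.1 (hω' n k)
  push_cast
  rw [abs_le]
  constructor <;> linarith [h1.1, h1.2]

end Allocation

/-! ### The stopping time -/

section Cost

variable {K : ℕ} {E : Type*} {𝓕 : Set (ProbabilityMeasure ℝ)} {T : ProbabilityMeasure ℝ → E}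

theorem transportCost_const_mul {x : ℝ} (hx : 0 < x) (i j : Fin K) (t : Fin K → E)
    (w : Fin K → ℝ) :
    transportCost 𝓕 T i j t (fun k => x * w k) =
      ENNReal.ofReal x * transportCost 𝓕 T i j t w := by
  have h0 : ENNReal.ofReal x ≠ 0 := by simpa using hx
  simp only [transportCost, ENNReal.mul_iInf_of_ne h0 ENNReal.ofReal_ne_top,
    ENNReal.ofReal_mul hx.le, mul_add, mul_assoc]

theorem minTransportCost_const_mul {x : ℝ} (hx : 0 < x) (i : Fin K) (t : Fin K → E)
    (w : Fin K → ℝ) :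
    minTransportCost 𝓕 T i t (fun k => x * w k) =
      ENNReal.ofReal x * minTransportCost 𝓕 T i t w := by
  have h0 : ENNReal.ofReal x ≠ 0 := by simpa using hx
  simp only [minTransportCost, ENNReal.mul_iInf_of_ne h0 ENNReal.ofReal_ne_top,
    transportCost_const_mul hx]

/-- Distributions whose images under `T` are close to those of `F` also have `i` as unique best arm,
and their transportation cost from `i` is not much smaller than that of `F`. -/
theorem exists_radius [MetricSpace E] (hT : IsCharacterization 𝓕 T) {β : ℝ}
    (hcont : ContinuityProperty K 𝓕 T β) {F : Fin K → ProbabilityMeasure ℝ} {i : Fin K}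
    (hF : F ∈ instances K 𝓕 i) {w : Fin K → ℝ} (hw : w ∈ stdSimplex ℝ (Fin K)) {v : ℝ≥0∞}
    (hv : v < minTransportCost 𝓕 T i (fun k => T (F k)) w) :
    ∃ ρ : ℝ, 0 < ρ ∧ ∀ (G : Fin K → ProbabilityMeasure ℝ) (w' : Fin K → ℝ),
      (∀ k, Integrable (fun x : ℝ => x) (G k : Measure ℝ)) → (∀ k, T (G k) ∈ T '' 𝓕) →
      (∀ k, dist (T (G k)) (T (F k)) ≤ ρ) → w' ∈ stdSimplex ℝ (Fin K) →
      (∀ k, |w' k - w k| ≤ ρ) →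
        IsUniqueBest G i ∧ v < minTransportCost 𝓕 T i (fun k => T (G k)) w' := by
  obtain ⟨m, hm, hmT⟩ := hcont.mean_continuous
  have hcost := hcont.cost_continuous i ((fun k => T (F k)), w) ⟨⟨F, hF, rfl⟩, hw⟩
  obtain ⟨ρ₁, hρ₁, hb₁⟩ := Metric.mem_nhdsWithin_iff.1 (hcost.eventually_const_lt hv)
  -- the conditions on the means are open, and `m ∘ T` is continuous
  have hmk : ∀ k, Tendsto (fun t : Fin K → E => m (t k))
      (𝓝[Set.univ.pi fun _ => T '' 𝓕] fun k => T (F k)) (𝓝 (mean (F k))) := fun k => by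
    have h1 : Tendsto m (𝓝[T '' 𝓕] (T (F k))) (𝓝 (mean (F k))) := by
      rw [← hmT _ (hF.1 k)]
      exact hm _ ⟨_, hF.1 k, rfl⟩
    refine h1.comp (tendsto_nhdsWithin_iff.2 ⟨?_, ?_⟩)
    · exact ((continuous_apply k).tendsto _).mono_left nhdsWithin_le_nhds
    · exact eventually_nhdsWithin_of_forall fun t ht => ht k (mem_univ k)
  have hev : ∀ᶠ t in 𝓝[Set.univ.pi fun _ => T '' 𝓕] (fun k => T (F k)),
      (∀ k, k ≠ i → m (t k) < m (t i)) ∧ ∀ k, m (t k) ∈ interior (meanSet 𝓕) := by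
    refine (eventually_all.2 fun k => ?_).and (eventually_all.2 fun k => ?_)
    · by_cases hk : k = i
      · exact Eventually.of_forall fun t h => absurd hk h
      · exact ((hmk k).eventually_lt (hmk i) (hF.2.1 k hk)).mono fun t ht _ => ht
    · exact (hmk k).eventually_mem (isOpen_interior.mem_nhds (hF.2.2 k))
  obtain ⟨ρ₂, hρ₂, hb₂⟩ := Metric.mem_nhdsWithin_iff.1 hev
  have hρ : 0 < min ρ₁ ρ₂ / 2 := by positivity
  refine ⟨min ρ₁ ρ₂ / 2, hρ, fun G w' hGi hGT hd hw' hdw => ?_⟩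
  have hlt₁ : min ρ₁ ρ₂ / 2 < ρ₁ := by linarith [min_le_left ρ₁ ρ₂]
  have hlt₂ : min ρ₁ ρ₂ / 2 < ρ₂ := by linarith [min_le_right ρ₁ ρ₂]
  have hdist : dist (fun k => T (G k)) (fun k => T (F k)) ≤ min ρ₁ ρ₂ / 2 :=
    (dist_pi_le_iff hρ.le).2 hd
  obtain ⟨hbest, hint⟩ := hb₂ ⟨hdist.trans_lt hlt₂, fun k _ => hGT k⟩
  choose H hH hHG using hGT
  have hmG : ∀ k, m (T (G k)) = mean (G k) := fun k => by
    rw [← hHG k, hmT _ (hH k), hT.mean_eq _ (hH k) _ (hGi k) (hHG k).symm]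
  have hmH : ∀ k, m (T (G k)) = mean (H k) := fun k => by rw [← hHG k, hmT _ (hH k)]
  refine ⟨fun j hj => by simpa only [hmG] using hbest j hj, ?_⟩
  have hHinst : H ∈ instances K 𝓕 i :=
    ⟨hH, fun j hj => by simpa only [hmH] using hbest j hj,
      fun k => by simpa only [hmH] using hint k⟩
  refine hb₁ (a := ((fun k => T (G k)), w')) ⟨?_, ⟨⟨H, hHinst, funext hHG⟩, hw'⟩⟩
  rw [Metric.mem_ball, Prod.dist_eq]
  refine (max_le hdist ((dist_pi_le_iff hρ.le).2 fun k => ?_)).trans_lt hlt₁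
  rw [Real.dist_eq]
  exact hdw k

end Cost

section Stopping

variable {K : ℕ} {𝒰 : Type*} [MeasurableSpace 𝒰] {A : Mechanism K 𝒰} {β : ℝ}
  {E : Type*} {𝓕 : Set (ProbabilityMeasure ℝ)} {T : ProbabilityMeasure ℝ → E}
  {F : Fin K → ProbabilityMeasure ℝ} {istar : Fin K} {w : Fin K → ℝ}
  {r : ℕ → Sample K 𝒰 → Fin K}

theorem integrable_empirical (ω : Sample K 𝒰) (n : ℕ) (i : Fin K) :
    Integrable (fun x : ℝ => x) (empirical A β ω n i : Measure ℝ) := by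
  by_cases h : (pulls A β ω n i).Nonempty
  · have hs : Integrable (fun x : ℝ => x)
        (∑ t ∈ pulls A β ω n i, Measure.dirac (reward A β ω t)) :=
      integrable_finsetSum_measure.2 fun t _ => integrable_dirac (by simp)
    have hc : ((pulls A β ω n i).card : ℝ≥0∞)⁻¹ ≠ ∞ := by simpa using h.ne_empty
    have he : (empirical A β ω n i : Measure ℝ) = ((pulls A β ω n i).card : ℝ≥0∞)⁻¹ •
        ∑ t ∈ pulls A β ω n i, Measure.dirac (reward A β ω t) :=
      congrArg Subtype.val (dif_pos h)
    rw [he]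
    exact hs.smul_measure hc
  · have he : (empirical A β ω n i : Measure ℝ) = Measure.dirac 0 :=
      congrArg Subtype.val (dif_neg h)
    rw [he]
    exact integrable_dirac (by simp)

theorem weights_mem_stdSimplex (ω : Sample K 𝒰) {n : ℕ} (hn : 0 < n) :
    (fun k => (numPulls A β ω n k : ℝ) / n) ∈ stdSimplex ℝ (Fin K) := by
  refine ⟨fun k => by positivity, ?_⟩
  have hn' : (n : ℝ) ≠ 0 := by positivity
  rw [← Finset.sum_div, div_eq_one_iff_eq hn']
  exact_mod_cast sum_numPulls A β ω n

theorem iInf_empCost_eq (ω : Sample K 𝒰) {n : ℕ} (hn : 0 < n) (i : Fin K) :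
    ⨅ j ∈ {j | j ≠ i}, empCost 𝓕 T A β ω n i j = ENNReal.ofReal n *
      minTransportCost 𝓕 T i (fun k => T (empirical A β ω n k))
        (fun k => (numPulls A β ω n k : ℝ) / n) := by
  have hn' : (0 : ℝ) < n := by positivity
  rw [← minTransportCost_const_mul hn']
  simp only [mul_div_cancel₀ _ hn'.ne']
  rfl

/-- From some time with finite expectation on, the statistic of the stopping rule exceeds `n v`, for
any `v` below the optimal value. As the optimal weights are positive, every arm is then pulled
linearly often, so that a random time with finite expectation suffices for the convergence of the
empirical distributions. -/
theorem exists_stoppingTime_le [MetricSpace E] (hT : IsCharacterization 𝓕 T)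
    (hcont : ContinuityProperty K 𝓕 T β) (hβ : β ∈ Ioo (0 : ℝ) 1)
    (hF : F ∈ instances K 𝓕 istar) (hrate : RateProperty 𝓕 T A β F)
    (hexp : SufficientExploration A β F)
    (hleader : LeaderConverges A β F istar) (hchallenger : ChallengerConverges 𝓕 T A β F istar)
    (hw : w ∈ optimalAllocations 𝓕 T β F istar) (hwpos : ∀ k, 0 < w k)
    (hr : IsRecommendation A β r) (c : ℕ → ℝ → ℝ≥0) {v : ℝ≥0}
    (hv : (v : ℝ≥0∞) < minTransportCost 𝓕 T istar (fun k => T (F k)) w) :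
    ∃ N : Sample K 𝒰 → ℝ≥0, HasFiniteMean (law A F) N ∧
      ∀ᵐ ω ∂(law A F), ∀ n : ℕ, (N ω : ℝ) ≤ n → ∀ δ : ℝ, (c n δ : ℝ) ≤ n * v →
        stoppingTime 𝓕 T A β r c δ ω ≤ n := by
  obtain ⟨ρ, hρ, hball⟩ := exists_radius hT hcont hF hw.1.1 hv
  have : Nonempty (Fin K) := ⟨istar⟩
  obtain ⟨k₀, hk₀⟩ := Finite.exists_min w
  obtain ⟨η, hη, hηρ, hηw⟩ : ∃ η : ℝ, 0 < η ∧ η ≤ ρ ∧ η ≤ w k₀ :=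
    ⟨min ρ (w k₀), lt_min hρ (hwpos k₀), min_le_left _ _, min_le_right _ _⟩
  obtain ⟨Nw, hNw, haew⟩ := exists_abs_numPulls_sub_weight_le hβ hexp hleader hchallenger hw
    (half_pos hη)
  obtain ⟨Nr, hNr, haer⟩ := hrate ρ hρ
  have hq : (((2 / η).toNNReal : ℝ≥0) : ℝ) = 2 / η := Real.coe_toNNReal _ (by positivity)
  refine ⟨fun ω => (2 / η).toNNReal * (Nw ω + Nr ω) + (K + 1),
    ((hNw.add hNr).const_mul _).add (hasFiniteMean_const _), ?_⟩
  filter_upwards [haew, haer] with ω hωw hωr n hn δ hcn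
  push_cast at hn
  rw [hq] at hn
  have hNw0 := (Nw ω).coe_nonneg
  have hNr0 := (Nr ω).coe_nonneg
  have hK0 : (0 : ℝ) ≤ K := by positivity
  have hpos : 0 ≤ 2 / η * ((Nw ω : ℝ) + Nr ω) := by positivity
  have hn0 : (0 : ℝ) < n := by linarith
  have hKn : K ≤ n := by
    have : (K : ℝ) ≤ n := by linarith
    exact_mod_cast this
  have hηn : (Nw ω : ℝ) + Nr ω ≤ η / 2 * n := by
    have h1 : 2 / η * ((Nw ω : ℝ) + Nr ω) ≤ n := by linarith
    calc (Nw ω : ℝ) + Nr ω = η / 2 * (2 / η * ((Nw ω : ℝ) + Nr ω)) := by field_simp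
      _ ≤ η / 2 * n := by gcongr
  have hclose : ∀ k, |(numPulls A β ω n k : ℝ) / n - w k| ≤ ρ := fun k => by
    have h1 : (numPulls A β ω n k : ℝ) / n - w k = ((numPulls A β ω n k : ℝ) - w k * n) / n := by
      field_simp
    rw [h1, abs_div, abs_of_pos hn0, div_le_iff₀ hn0]
    have h2 := hωw n k
    have h3 : η * n ≤ ρ * n := by gcongr
    linarith
  have hmany : ∀ k, (Nr ω : ℝ) ≤ numPulls A β ω n k := fun k => by
    have h2 := (abs_le.1 (hωw n k)).1
    have h3 : η * n ≤ w k * n := by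
      gcongr
      exact hηw.trans (hk₀ k)
    linarith
  obtain ⟨hbest, hlt⟩ := hball (fun k => empirical A β ω n k)
    (fun k => (numPulls A β ω n k : ℝ) / n) (fun k => integrable_empirical ω n k)
    (fun k => (hωr k n (hmany k)).1) (fun k => (hωr k n (hmany k)).2)
    (weights_mem_stdSimplex ω (by exact_mod_cast hn0)) hclose
  have hrec : r n ω = istar := by
    by_contra hne
    exact absurd (hr n hKn ω istar) (not_le.2 (hbest _ hne))
  refine iInf₂_le (f := fun (n : ℕ) _ => (n : ℕ∞)) n ⟨hKn, ?_⟩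
  rw [hrec, iInf_empCost_eq ω (by exact_mod_cast hn0)]
  calc (c n δ : ℝ≥0∞) ≤ ENNReal.ofReal n * v := by
        rw [ENNReal.ofReal_natCast]
        have : c n δ ≤ n * v := by exact_mod_cast hcn
        exact_mod_cast this
    _ < _ := ENNReal.mul_lt_mul_right (by simpa using hn0.ne') ENNReal.ofReal_ne_top hlt

theorem tendsto_const_div_log {x : ℝ≥0∞} (hx : x ≠ ∞) :
    Tendsto (fun δ : ℝ => x / ENNReal.ofReal (Real.log (1 / δ))) (𝓝[>] 0) (𝓝 0) := by
  have h : Tendsto (fun δ : ℝ => ENNReal.ofReal (Real.log (1 / δ))) (𝓝[>] 0) (𝓝 ∞) := by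
    simp only [one_div]
    exact ENNReal.tendsto_ofReal_atTop.comp
      (Real.tendsto_log_atTop.comp (tendsto_inv_nhdsGT_zero (𝕜 := ℝ)))
  simpa using ENNReal.Tendsto.const_div h (Or.inr hx)

/-- If, for every `v < V`, `τ_δ ≤ n` for all large `n` with `c n δ ≤ n v`, then
`τ_δ` is asymptotically at most `log (1 / δ) / V` in expectation: since the threshold is at most
`f δ + o(n)`, any `n` larger than `f δ / s`, with `s < v`, and than terms of smaller order will
do. -/
theorem limsup_expectedStoppingTime_le {c : ℕ → ℝ → ℝ≥0} (hc : AsymptoticallyTight c)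
    {V : ℝ≥0∞}
    (h : ∀ v : ℝ≥0, (v : ℝ≥0∞) < V →
      ∃ N : Sample K 𝒰 → ℝ≥0, HasFiniteMean (law A F) N ∧
        ∀ᵐ ω ∂(law A F), ∀ n : ℕ, (N ω : ℝ) ≤ n → ∀ δ : ℝ, (c n δ : ℝ) ≤ n * v →
          stoppingTime 𝓕 T A β r c δ ω ≤ n) :
    limsup (fun δ : ℝ => expectedStoppingTime 𝓕 T A β F r c δ /
      ENNReal.ofReal (Real.log (1 / δ))) (𝓝[>] 0) ≤ V⁻¹ := by
  obtain ⟨a, δ₀, C, f, S, -, ha, hδ₀, -, hcb, hf, hS⟩ := hc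
  refine le_of_forall_gt_imp_ge_of_dense fun y hy => ?_
  obtain ⟨s, hys, hsV⟩ := ENNReal.lt_iff_exists_nnreal_btwn.1 (ENNReal.inv_lt_iff_inv_lt.1 hy)
  obtain ⟨v, hsv, hvV⟩ := ENNReal.lt_iff_exists_nnreal_btwn.1 hsV
  have hs0 : (s : ℝ≥0∞) ≠ 0 := (pos_of_gt hys).ne'
  have hspos : (0 : ℝ) < s := by
    have : s ≠ 0 := by simpa using hs0
    positivity
  have hsv' : (s : ℝ) < v := by exact_mod_cast hsv
  -- `1 < b < y s` absorbs the error in `f`, and `e` the two terms that are `o(log (1 / δ))`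
  have hone : 1 < y * s := by
    have := ENNReal.mul_lt_mul_left hs0 ENNReal.coe_ne_top (ENNReal.inv_lt_iff_inv_lt.1 hys)
    rwa [ENNReal.inv_mul_cancel hs0 ENNReal.coe_ne_top] at this
  obtain ⟨b, hb1, hby⟩ := exists_between hone
  have hbs : b * (s : ℝ≥0∞)⁻¹ < y := by
    rw [← div_eq_mul_inv]
    exact ENNReal.div_lt_of_lt_mul hby
  set e : ℝ≥0∞ := (y - b * (s : ℝ≥0∞)⁻¹) / 2 with he
  have he0 : 0 < e := ENNReal.half_pos (tsub_pos_of_lt hbs).ne'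
  have hsum : e + e + b * (s : ℝ≥0∞)⁻¹ ≤ y := by
    rw [he, ENNReal.add_halves, tsub_add_cancel_of_le hbs.le]
  obtain ⟨N, hN, hae⟩ := h v hvV
  have hη : 0 < ((v : ℝ) - s) / (|C| + 1) := div_pos (sub_pos.2 hsv') (by positivity)
  obtain ⟨D, hD0, hD⟩ := exists_forall_rpow_le_mul ha hη
  set m : ℝ≥0∞ := ∫⁻ ω, (N ω : ℝ≥0∞) ∂(law A F) with hm
  have hbound : ∀ δ : ℝ, 0 < δ → δ ≤ δ₀ → expectedStoppingTime 𝓕 T A β F r c δ ≤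
      (m + (D + 1)) + S δ + f δ * (s : ℝ≥0∞)⁻¹ := by
    intro δ hδ hδle
    have hpt : ∀ᵐ ω ∂(law A F), ((stoppingTime 𝓕 T A β r c δ ω : ℕ∞) : ℝ≥0∞) ≤
        N ω + ((D + 1) + S δ + f δ * (s : ℝ≥0∞)⁻¹) := by
      filter_upwards [hae] with ω hω
      set x : ℝ≥0 := N ω + (D + S δ + f δ * s⁻¹) with hx
      have hxn : (x : ℝ) ≤ ⌈x⌉₊ := by exact_mod_cast Nat.le_ceil x
      have hxe : (x : ℝ) = N ω + (D + S δ + f δ * (s : ℝ)⁻¹) := by rw [hx]; push_cast; rfl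
      have h1 := (N ω).coe_nonneg
      have h2 := D.coe_nonneg
      have h3 := (S δ).coe_nonneg
      have h4 : 0 ≤ (f δ : ℝ) * (s : ℝ)⁻¹ := by positivity
      have hfs : (f δ : ℝ) ≤ ⌈x⌉₊ * s := by
        rw [← div_le_iff₀ hspos, div_eq_mul_inv]
        linarith
      have hC : C * (⌈x⌉₊ : ℝ) ^ a ≤ (v - s) * ⌈x⌉₊ := by
        have hr0 : (0 : ℝ) ≤ (⌈x⌉₊ : ℝ) ^ a := by positivity
        calc C * (⌈x⌉₊ : ℝ) ^ a ≤ (|C| + 1) * (⌈x⌉₊ : ℝ) ^ a := by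
              gcongr
              linarith [le_abs_self C]
          _ ≤ (|C| + 1) * (((v : ℝ) - s) / (|C| + 1) * ⌈x⌉₊) := by
              gcongr
              exact hD _ (by linarith)
          _ = (v - s) * ⌈x⌉₊ := by
              have : |C| + 1 ≠ 0 := by positivity
              field_simp
      have hτ := hω ⌈x⌉₊ (by linarith) δ (by
        have := hcb δ hδ hδle ⌈x⌉₊ (by linarith)
        linarith)
      have hceil : ((⌈x⌉₊ : ℕ) : ℝ≥0) ≤ x + 1 := (Nat.ceil_lt_add_one zero_le).le
      calc ((stoppingTime 𝓕 T A β r c δ ω : ℕ∞) : ℝ≥0∞) ≤ ((⌈x⌉₊ : ℕ∞) : ℝ≥0∞) := by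
            exact_mod_cast hτ
        _ = (((⌈x⌉₊ : ℕ) : ℝ≥0) : ℝ≥0∞) := by simp
        _ ≤ ((x + 1 : ℝ≥0) : ℝ≥0∞) := by exact_mod_cast hceil
        _ = _ := by
            have : s ≠ 0 := by simpa using hs0
            rw [hx]
            push_cast [ENNReal.coe_inv this]
            ring
    refine (lintegral_mono_ae hpt).trans (le_of_eq ?_)
    rw [lintegral_add_right _ measurable_const, lintegral_const, measure_univ, mul_one, ← hm]
    ring
  have hm_top : m + (D + 1) ≠ ∞ := by
    simp [hm, hN.2.ne]
  have hev1 := (tendsto_const_div_log hm_top).eventually_le_const he0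
  have hev2 := eventually_lt_of_limsup_lt (hS.trans_lt he0)
  have hev3 := eventually_lt_of_limsup_lt (hf.trans_lt hb1)
  refine limsup_le_of_le ⟨0, by simp⟩ ?_
  filter_upwards [hev1, hev2, hev3, Ioc_mem_nhdsGT hδ₀] with δ h1 h2 h3 hδ
  calc expectedStoppingTime 𝓕 T A β F r c δ / ENNReal.ofReal (Real.log (1 / δ))
      ≤ ((m + (D + 1)) + S δ + f δ * (s : ℝ≥0∞)⁻¹) / ENNReal.ofReal (Real.log (1 / δ)) :=
        ENNReal.div_le_div_right (hbound δ hδ.1 hδ.2) _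
    _ = (m + (D + 1)) / ENNReal.ofReal (Real.log (1 / δ)) +
        S δ / ENNReal.ofReal (Real.log (1 / δ)) +
        f δ / ENNReal.ofReal (Real.log (1 / δ)) * (s : ℝ≥0∞)⁻¹ := by
        simp only [div_eq_mul_inv, add_mul]
        ring
    _ ≤ e + e + b * (s : ℝ≥0∞)⁻¹ := by gcongr
    _ ≤ y := hsum

end Stopping

end TopTwo

theorem mainTheorem3 {K : ℕ} (hK : 2 ≤ K) {E : Type*} [MetricSpace E]
    -- the class of distributions and the operator that characterizes its members
    (𝓕 : Set (ProbabilityMeasure ℝ))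
    (h𝓕 : ∀ F ∈ 𝓕, Integrable (fun x : ℝ => x) (F : Measure ℝ))
    (T : ProbabilityMeasure ℝ → E) (hT : TopTwo.IsCharacterization 𝓕 T)
    (β : ℝ) (hβ : β ∈ Ioo (0 : ℝ) 1)
    (hcont : TopTwo.ContinuityProperty K 𝓕 T β)
    -- the sampling rule and the threshold
    {𝒰 : Type*} [MeasurableSpace 𝒰] (A : TopTwo.Mechanism K 𝒰)
    (c : ℕ → ℝ → ℝ≥0) (hc : TopTwo.AsymptoticallyTight c)
    -- the instance, with best arm `istar`
    (F : Fin K → ProbabilityMeasure ℝ) (hF : ∀ i, F i ∈ 𝓕)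
    (hdistinct : ∀ i j, i ≠ j → TopTwo.mean (F i) ≠ TopTwo.mean (F j))
    (hinterior : ∀ i, TopTwo.mean (F i) ∈ interior (TopTwo.meanSet 𝓕))
    (istar : Fin K) (hstar : TopTwo.IsUniqueBest F istar)
    (hrate : TopTwo.RateProperty 𝓕 T A β F)
    -- the properties of the leader and of the challenger
    (B C : ℕ → TopTwo.Sample K 𝒰 → Fin K)
    (hB : TopTwo.IsEffectiveLeader A β B) (hC : TopTwo.IsEffectiveChallenger A β B C)
    (hleader : TopTwo.LeaderExplores A β F B)
    (hchallenger : TopTwo.ChallengerExplores A β F B C)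
    (hleader_conv : TopTwo.LeaderConverges A β F istar)
    (hchallenger_conv : TopTwo.ChallengerConverges 𝓕 T A β F istar)
    -- the recommendation rule
    (r : ℕ → TopTwo.Sample K 𝒰 → Fin K) (hr : TopTwo.IsRecommendation A β r) :
    limsup (fun δ : ℝ => TopTwo.expectedStoppingTime 𝓕 T A β F r c δ /
        ENNReal.ofReal (Real.log (1 / δ))) (𝓝[>] 0) ≤
      TopTwo.charTime 𝓕 T β F istar := by
  have hinst : F ∈ TopTwo.instances K 𝓕 istar := ⟨hF, hstar, hinterior⟩
  obtain ⟨w, hw, hwpos⟩ := hcont.unique_allocation istar F hinst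
  have hwopt : w ∈ TopTwo.optimalAllocations 𝓕 T β F istar := hw ▸ mem_singleton w
  have hexp := TopTwo.sufficientExploration hβ hdistinct hB hC hleader hchallenger
  refine (TopTwo.limsup_expectedStoppingTime_le hc fun v hv =>
    TopTwo.exists_stoppingTime_le hT hcont hβ hinst hrate hexp hleader_conv hchallenger_conv
      hwopt hwpos hr c hv).trans ?_
  exact ENNReal.inv_le_inv.2 (iSup₂_le fun u hu => hwopt.2 u hu)
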